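/- Let $\Phi_4 = x^3y+y^3z+z^3x$ be the Klein quartic in $\mathbb{P}^2_{\mathbb{C}}$. The polar of $\Phi_4$ with respect to a point $p=(a:b:c)\in\mathbb{P}^2_{\mathbb{C}}$ is the cubic curve $$a\,\frac{\partial\Phi_4}{\partial x}+b\,\frac{\partial\Phi_4}{\partial y}+c\,\frac{\partial\Phi_4}{\partial z}=0 .$$ Let $\mathcal{K}_2$ be the set of all smooth conics in $\mathbb{P}^2_{\mathbb{C}}$ that are components of reducible polars of $\Phi_4$. Then the following hold. (1) $\Phi_4$ has exactly $21$ reducible polars, each of them has exactly one smooth conic as a component, and $\mathcal{K}_2$ consists of exactly $21$ conics. (2) The arrangement $\mathcal{K}_2$ has only ordinary (transversal) singularities: at every point lying on at least two conics of $\mathcal{K}_2$, the conics of $\mathcal{K}_2$ through that point have pairwise distinct tangent lines there. Every such point is a double or a triple point, that is, it lies on exactly two or exactly three conics of $\mathcal{K}_2$. (3) There are exactly $224 = 8\cdot 21+56$ triple points and exactly $168 = 21\cdot 8$ double points. -/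

import Mathlib

open MvPolynomial
open scoped LinearAlgebra.Projectivization

noncomputable section

/-- The complex projective plane. -/
abbrev ProjPlane : Type := ℙ ℂ (Fin 3 → ℂ)

/-- A plane curve of degree `d`: a nonzero form of degree `d` in three variables, up to a nonzero
scalar. -/
abbrev PlaneCurve (d : ℕ) : Type := ℙ ℂ (homogeneousSubmodule (Fin 3) ℂ d)

/-- The gradient of a form at a vector of homogeneous coordinates. -/
def formGradient (F : MvPolynomial (Fin 3) ℂ) (v : Fin 3 → ℂ) : Fin 3 → ℂ :=
  fun i => eval v (pderiv i F)

/-- The form `a ∂F/∂x + b ∂F/∂y + c ∂F/∂z`, the equation of the polar of `F = 0` with respect to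
the point `(a : b : c)`. -/
def polarForm (F : MvPolynomial (Fin 3) ℂ) (p : Fin 3 → ℂ) : MvPolynomial (Fin 3) ℂ :=
  ∑ i, C (p i) * pderiv i F

/-- The polar vanishes at `v` exactly when the gradient map sends `v` to the line dual to `p`. -/
theorem eval_polarForm (F : MvPolynomial (Fin 3) ℂ) (p v : Fin 3 → ℂ) :
    eval v (polarForm F p) = ∑ i, p i * formGradient F v i := by
  simp [polarForm, formGradient]

theorem polarForm_smul (F : MvPolynomial (Fin 3) ℂ) (c : ℂ) (p : Fin 3 → ℂ) :
    polarForm F (c • p) = c • polarForm F p := by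
  simp [polarForm, Finset.smul_sum, smul_eq_C_mul, mul_assoc]

namespace PlaneCurve

variable {d e : ℕ}

/-- An equation of the curve (any two differ by a nonzero scalar). -/
def form (Γ : PlaneCurve d) : MvPolynomial (Fin 3) ℂ :=
  (Projectivization.rep Γ : homogeneousSubmodule (Fin 3) ℂ d)

/-- The point `P` lies on the curve `Γ`. -/
def Contains (Γ : PlaneCurve d) (P : ProjPlane) : Prop :=
  eval P.rep (form Γ) = 0

/-- Lying on a curve does not depend on the chosen equation and homogeneous coordinates. -/
theorem contains_mk (F : homogeneousSubmodule (Fin 3) ℂ d) (hF : F ≠ 0)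
    (v : Fin 3 → ℂ) (hv : v ≠ 0) :
    Contains (Projectivization.mk ℂ F hF) (Projectivization.mk ℂ v hv) ↔
      eval v (F : MvPolynomial (Fin 3) ℂ) = 0 := by
  obtain ⟨a, ha⟩ := Projectivization.exists_smul_eq_mk_rep ℂ F hF
  obtain ⟨b, hb⟩ := Projectivization.exists_smul_eq_mk_rep ℂ v hv
  have hom : (F : MvPolynomial (Fin 3) ℂ).IsHomogeneous d :=
    (mem_homogeneousSubmodule d _).1 F.2
  have key : eval ((b : ℂ) • v) (F : MvPolynomial (Fin 3) ℂ)
      = (b : ℂ) ^ d * eval v (F : MvPolynomial (Fin 3) ℂ) := by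
    simp only [eval_eq, Finset.mul_sum, Pi.smul_apply, smul_eq_mul, mul_pow,
      Finset.prod_mul_distrib, Finset.prod_pow_eq_pow_sum]
    refine Finset.sum_congr rfl fun m hm => ?_
    have hdeg : ∑ i ∈ m.support, m i = d := by
      have h := hom (mem_support_iff.1 hm)
      rw [Finsupp.weight_apply] at h
      simpa [Finsupp.sum] using h
    rw [hdeg]
    ring
  unfold Contains form
  rw [← ha, ← hb, Units.smul_def, Units.smul_def, Submodule.coe_smul, smul_eval, key]
  simp

/-- The curve `Γ` is smooth: its gradient vanishes at none of its points. -/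
def IsSmooth (Γ : PlaneCurve d) : Prop :=
  ∀ P : ProjPlane, Contains Γ P → formGradient (form Γ) P.rep ≠ 0

/-- The curve `Δ` is contained in `Γ` as a divisor: its equation divides that of `Γ`. -/
def IsPartOf (Δ : PlaneCurve e) (Γ : PlaneCurve d) : Prop :=
  form Δ ∣ form Γ

/-- The curve `Γ` is reducible: its equation is a product of two nonunits (the factors of a form are
automatically forms). -/
def IsReducible (Γ : PlaneCurve d) : Prop :=
  ∃ A B : MvPolynomial (Fin 3) ℂ, ¬ IsUnit A ∧ ¬ IsUnit B ∧ form Γ = A * B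

/-- `Γ` and `Δ` meet transversally at `P`: both pass through `P`, are smooth there, and their
tangent lines at `P` are distinct. -/
def TransversalAt (Γ : PlaneCurve d) (Δ : PlaneCurve e) (P : ProjPlane) : Prop :=
  Contains Γ P ∧ Contains Δ P ∧
    LinearIndependent ℂ ![formGradient (form Γ) P.rep, formGradient (form Δ) P.rep]

end PlaneCurve

/-- The members of the arrangement `A` that pass through `P`. -/
def curvesThrough {d : ℕ} (A : Set (PlaneCurve d)) (P : ProjPlane) : Set (PlaneCurve d) :=
  {Γ | Γ ∈ A ∧ PlaneCurve.Contains Γ P}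

/-- The number of members of the arrangement `A` that pass through `P`. -/
def arrangementMult {d : ℕ} (A : Set (PlaneCurve d)) (P : ProjPlane) : ℕ∞ :=
  (curvesThrough A P).encard

/-- The singular points of an arrangement `A`: the points where two or more members meet, and the
singular points of the members. -/
def arrangementSing {d : ℕ} (A : Set (PlaneCurve d)) : Set ProjPlane :=
  {P | 2 ≤ arrangementMult A P ∨
    ∃ Γ ∈ curvesThrough A P, formGradient (PlaneCurve.form Γ) P.rep = 0}

/-- `P` is an ordinary (transversal) point of the arrangement `A`: the members through `P` are
smooth at `P` with pairwise distinct tangent lines. -/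
def IsOrdinaryAt {d : ℕ} (A : Set (PlaneCurve d)) (P : ProjPlane) : Prop :=
  (∀ Γ ∈ curvesThrough A P, formGradient (PlaneCurve.form Γ) P.rep ≠ 0) ∧
    (curvesThrough A P).Pairwise fun Γ Δ => PlaneCurve.TransversalAt Γ Δ P

/-- The equation `x³y + y³z + z³x` of the Klein quartic. -/
def kleinQuartic : MvPolynomial (Fin 3) ℂ :=
  X 0 ^ 3 * X 1 + X 1 ^ 3 * X 2 + X 2 ^ 3 * X 0

/-- The reducible polars of the Klein quartic, as plane cubic curves. -/
def kleinReduciblePolars : Set (PlaneCurve 3) :=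
  {Γ | PlaneCurve.IsReducible Γ ∧
    ∃ p : ProjPlane, ∃ c : ℂˣ, PlaneCurve.form Γ = (c : ℂ) • polarForm kleinQuartic p.rep}

/-- The arrangement of the smooth conics that are components of reducible polars of the Klein
quartic. (A smooth conic is irreducible.) -/
def polarConics : Set (PlaneCurve 2) :=
  {Q | PlaneCurve.IsSmooth Q ∧ ∃ Γ ∈ kleinReduciblePolars, PlaneCurve.IsPartOf Q Γ}

end

/-!
Two systems of coordinates are used. In the coordinates of the Klein quartic its group of order 21,
generated by `diag(ζ, ζ⁴, ζ²)` with `ζ⁷ = 1` and by the cyclic permutations of the coordinates, acts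
monomially, which makes the reducible polars easy to classify. A projectively equivalent quartic
`x⁴ + y⁴ + z⁴ + 3α(x²y² + y²z² + z²x²)` with `α² + α + 2 = 0` has the octahedral symmetries, and one
of the conics becomes diagonal there, which makes its intersections with the others easy to find.

Reducible polars. A reducible cubic contains a line (`exists_line_of_cubic_eq_mul`). If the polar of
`p` contains the line `z = m x + n y`, then comparing coefficients gives a cubic equation for
`w = m² n`, the value of `m⁷` in terms of `w`, and `p` up to scaling in terms of `w` and `m`
(`exists_params_of_line`). Hence there are at most `3 * 7 = 21` such points, and the group of
order 21 permutes them simply transitively (`exists_eq_frobeniusChange`,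
`frobeniusChange_kleinCentre_injective`). One of them is the image of the point `(1 : 0 : 0)` of the
octahedral quartic, whose polar is the line `x = 0` together with the smooth conic
`2x² + 3α(y² + z²) = 0`, the base conic. So there are 21 reducible polars. A cubic contains at
most one smooth conic (`eq_of_isSmooth_of_dvd`), and the base conic divides no other polar
(`eq_smul_of_baseConic_dvd`), so that there are also 21 conics.

Singular points. It is enough to understand the points on the base conic, because each of the 21
conics is its image under a projective transformation that preserves the arrangement. The base conic
is parametrized by rational functions, and restricting a second conic to it gives a binary quartic
form: there are at most four intersections, and at most three if one of them is not transversal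
(`encard_baseConic_inter_le`). Thus there are at most `20 * 4 = 80` incidences of the other
20 conics with points on the base conic. On the other hand, seven orbits of the symmetries of the
square in the coordinates `y, z` provide 32 points on the base conic that lie on two more conics
each, and 16 points that lie on one more conic each (`exists_orbit_representatives`). These already
account for `32 * 2 + 16 = 80` incidences. So all bounds are equalities: there are no further
points, the multiplicities are exactly three and two, and all intersections are transversal
(`isBalanced_of_points`, `isBalanced_baseConic`). Double counting then gives `21 * 32 / 3 = 224`
triple points and `21 * 16 / 2 = 168` double points (`encard_mult_mul`).
-/

open PlaneCurve

noncomputable section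

/-! ### Linear changes of coordinates -/

/-- The linear automorphisms of the space of homogeneous coordinates. -/
abbrev CoordChange : Type := (Fin 3 → ℂ) ≃ₗ[ℂ] (Fin 3 → ℂ)

/-- The substitution `F ↦ F ∘ g` of a linear change of coordinates into a polynomial. -/
def substForm (g : CoordChange) : MvPolynomial (Fin 3) ℂ →ₐ[ℂ] MvPolynomial (Fin 3) ℂ :=
  aeval fun i => ∑ j, C (g (Pi.single j 1) i) * X j

theorem CoordChange.apply_eq_sum (g : CoordChange) (v : Fin 3 → ℂ) (i : Fin 3) :
    g v i = ∑ j, g (Pi.single j 1) i * v j := by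
  have h : ∀ j, Pi.single j (v j) = v j • (Pi.single j (1 : ℂ) : Fin 3 → ℂ) := fun j => by
    rw [← Pi.single_smul, smul_eq_mul, mul_one]
  conv_lhs => rw [← Finset.univ_sum_single v]
  simp only [map_sum, h, map_smul, Finset.sum_apply, Pi.smul_apply, smul_eq_mul, mul_comm]

theorem eval_substForm (g : CoordChange) (F : MvPolynomial (Fin 3) ℂ) (v : Fin 3 → ℂ) :
    eval v (substForm g F) = eval (g v) F := by
  have h : (g v) = fun i => eval v (∑ j, C (g (Pi.single j 1) i) * X j) := by
    ext i
    rw [g.apply_eq_sum]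
    simp
  rw [h, substForm]
  induction F using MvPolynomial.induction_on with
  | C a => simp
  | add p q hp hq => simp only [map_add, hp, hq]
  | mul_X p i hp => simp only [map_mul, hp, aeval_X, eval_X]

theorem substForm_substForm (g h : CoordChange) (F : MvPolynomial (Fin 3) ℂ) :
    substForm h (substForm g F) = substForm (g * h) F :=
  MvPolynomial.funext fun v => by simp only [eval_substForm, LinearEquiv.mul_apply]

theorem substForm_one (F : MvPolynomial (Fin 3) ℂ) : substForm 1 F = F :=
  MvPolynomial.funext fun v => by simp only [eval_substForm, LinearEquiv.coe_one, id]

theorem substForm_injective (g : CoordChange) : Function.Injective (substForm g) :=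
  Function.LeftInverse.injective (g := substForm g⁻¹) fun F => by
    rw [substForm_substForm, mul_inv_cancel, substForm_one]

theorem isHomogeneous_substForm (g : CoordChange) {F : MvPolynomial (Fin 3) ℂ} {d : ℕ}
    (hF : F.IsHomogeneous d) : (substForm g F).IsHomogeneous d := by
  have := hF.aeval (n := 1) (fun i => ∑ j, C (g (Pi.single j 1) i) * X j) fun i =>
    IsHomogeneous.sum _ _ _ fun j _ => isHomogeneous_C_mul_X _ _
  simpa [substForm] using this

/-- The chain rule for a linear substitution. -/
theorem formGradient_substForm_dotProduct (g : CoordChange) (F : MvPolynomial (Fin 3) ℂ)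
    (v p : Fin 3 → ℂ) :
    formGradient (substForm g F) v ⬝ᵥ p = formGradient F (g v) ⬝ᵥ g p := by
  have key : ∀ j, eval v (pderiv j (substForm g F)) =
      ∑ i, eval (g v) (pderiv i F) * g (Pi.single j 1) i := by
    intro j
    induction F using MvPolynomial.induction_on with
    | C a => simp [substForm]
    | add p q hp hq => simp only [map_add, hp, hq, add_mul, Finset.sum_add_distrib]
    | mul_X p k hp =>
      have hX : eval v (pderiv j (substForm g (X k))) = g (Pi.single j 1) k := by
        simp [substForm, pderiv_X, Pi.single_apply]
      have hX' : ∀ i, eval (g v) (pderiv i (X k : MvPolynomial (Fin 3) ℂ)) =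
          if i = k then 1 else 0 := by
        intro i
        simp only [pderiv_X, Pi.single_apply]
        by_cases h : i = k
        · simp [h]
        · simp [h, Ne.symm h]
      simp only [map_mul, Derivation.leibniz, smul_eq_mul, map_add, eval_substForm, hp, hX, hX']
      simp [add_mul, Finset.sum_add_distrib, Finset.mul_sum, mul_assoc]
  simp only [dotProduct, formGradient, key, Finset.sum_mul]
  rw [Finset.sum_comm]
  refine Finset.sum_congr rfl fun i _ => ?_
  rw [g.apply_eq_sum p i, Finset.mul_sum]
  exact Finset.sum_congr rfl fun j _ => by ring

theorem polarForm_substForm (g : CoordChange) (F : MvPolynomial (Fin 3) ℂ) (p : Fin 3 → ℂ) :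
    polarForm (substForm g F) p = substForm g (polarForm F (g p)) :=
  MvPolynomial.funext fun v => by
    have := formGradient_substForm_dotProduct g F v p
    simp only [dotProduct] at this
    simp only [eval_substForm, eval_polarForm]
    simpa only [mul_comm] using this

theorem polarForm_smul_form (F : MvPolynomial (Fin 3) ℂ) (c : ℂ) (p : Fin 3 → ℂ) :
    polarForm (c • F) p = c • polarForm F p := by
  simp [polarForm, Finset.smul_sum, smul_eq_C_mul, mul_left_comm]

theorem formGradient_smul (F : MvPolynomial (Fin 3) ℂ) (c : ℂ) (v : Fin 3 → ℂ) :
    formGradient (c • F) v = c • formGradient F v := by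
  ext i
  simp [formGradient, smul_eval]

theorem eval_smul_of_isHomogeneous {F : MvPolynomial (Fin 3) ℂ} {d : ℕ} (hF : F.IsHomogeneous d)
    (c : ℂ) (v : Fin 3 → ℂ) : eval (c • v) F = c ^ d * eval v F := by
  simp only [eval_eq, Finset.mul_sum, Pi.smul_apply, smul_eq_mul, mul_pow,
    Finset.prod_mul_distrib, Finset.prod_pow_eq_pow_sum]
  refine Finset.sum_congr rfl fun m hm => ?_
  have hdeg : ∑ i ∈ m.support, m i = d := by
    have h := hF (mem_support_iff.1 hm)
    rw [Finsupp.weight_apply] at h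
    simpa [Finsupp.sum] using h
  rw [hdeg]
  ring

theorem formGradient_smul_apply {F : MvPolynomial (Fin 3) ℂ} {d : ℕ} (hF : F.IsHomogeneous d)
    (c : ℂ) (v : Fin 3 → ℂ) : formGradient F (c • v) = c ^ (d - 1) • formGradient F v := by
  ext i
  simp [formGradient, eval_smul_of_isHomogeneous hF.pderiv]

/-! ### Plane curves and changes of coordinates -/

namespace PlaneCurve

variable {d e : ℕ}

theorem isHomogeneous_form (Γ : PlaneCurve d) : (form Γ).IsHomogeneous d :=
  (mem_homogeneousSubmodule d _).1 (Projectivization.rep Γ).2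

theorem form_ne_zero (Γ : PlaneCurve d) : form Γ ≠ 0 := fun h =>
  Projectivization.rep_nonzero Γ (Subtype.ext h)

/-- The plane curve with a given equation. -/
def ofForm (F : MvPolynomial (Fin 3) ℂ) (hF : F.IsHomogeneous d) (h0 : F ≠ 0) : PlaneCurve d :=
  Projectivization.mk ℂ
    (⟨F, (mem_homogeneousSubmodule d F).2 hF⟩ : homogeneousSubmodule (Fin 3) ℂ d)
    fun h => h0 (congrArg Subtype.val h)

theorem exists_form_ofForm (F : MvPolynomial (Fin 3) ℂ) (hF : F.IsHomogeneous d) (h0 : F ≠ 0) :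
    ∃ c : ℂ, c ≠ 0 ∧ form (ofForm F hF h0) = c • F := by
  obtain ⟨a, ha⟩ := Projectivization.exists_smul_eq_mk_rep ℂ
    (⟨F, (mem_homogeneousSubmodule d F).2 hF⟩ : homogeneousSubmodule (Fin 3) ℂ d)
    fun h => h0 (congrArg Subtype.val h)
  exact ⟨a, a.ne_zero, (congrArg Subtype.val ha).symm⟩

theorem ext_form {Γ Δ : PlaneCurve d} {c : ℂ} (h : form Γ = c • form Δ) : Γ = Δ := by
  rw [← Projectivization.mk_rep Γ, ← Projectivization.mk_rep Δ, Projectivization.mk_eq_mk_iff']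
  exact ⟨c, Subtype.ext h.symm⟩

theorem contains_ofForm {F : MvPolynomial (Fin 3) ℂ} (hF : F.IsHomogeneous d) (h0 : F ≠ 0)
    {v : Fin 3 → ℂ} (hv : v ≠ 0) :
    Contains (ofForm F hF h0) (Projectivization.mk ℂ v hv) ↔ eval v F = 0 :=
  contains_mk _ _ v hv

theorem contains_mk_iff (Γ : PlaneCurve d) {v : Fin 3 → ℂ} (hv : v ≠ 0) :
    Contains Γ (Projectivization.mk ℂ v hv) ↔ eval v (form Γ) = 0 := by
  have := contains_mk (Projectivization.rep Γ) (Projectivization.rep_nonzero Γ) v hv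
  rwa [Projectivization.mk_rep] at this

/-- Conditions on the gradient at the chosen representative of a point can be checked on any
homogeneous coordinates. -/
theorem formGradient_rep_mk (Γ : PlaneCurve d) {v : Fin 3 → ℂ} (hv : v ≠ 0) :
    ∃ c : ℂ, c ≠ 0 ∧
      formGradient (form Γ) (Projectivization.mk ℂ v hv).rep = c • formGradient (form Γ) v := by
  obtain ⟨a, ha⟩ := Projectivization.exists_smul_eq_mk_rep ℂ v hv
  refine ⟨(a : ℂ) ^ (d - 1), pow_ne_zero _ a.ne_zero, ?_⟩
  rw [← ha, Units.smul_def, formGradient_smul_apply (isHomogeneous_form Γ)]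

theorem linearIndependent_pair_smul_iff {u v : Fin 3 → ℂ} {a b : ℂ} (ha : a ≠ 0) (hb : b ≠ 0) :
    LinearIndependent ℂ ![a • u, b • v] ↔ LinearIndependent ℂ ![u, v] := by
  rw [LinearIndependent.pair_iff, LinearIndependent.pair_iff]
  constructor
  · intro h s t hst
    have := h (s * a⁻¹) (t * b⁻¹) (by
      rw [smul_smul, smul_smul, mul_assoc, mul_assoc, inv_mul_cancel₀ ha, inv_mul_cancel₀ hb]
      simpa using hst)
    simpa [ha, hb] using this
  · intro h s t hst
    have := h (s * a) (t * b) (by simpa [mul_smul] using hst)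
    simpa [ha, hb] using this

theorem transversalAt_mk_iff (Γ : PlaneCurve d) (Δ : PlaneCurve e) {v : Fin 3 → ℂ} (hv : v ≠ 0) :
    TransversalAt Γ Δ (Projectivization.mk ℂ v hv) ↔
      eval v (form Γ) = 0 ∧ eval v (form Δ) = 0 ∧
        LinearIndependent ℂ ![formGradient (form Γ) v, formGradient (form Δ) v] := by
  obtain ⟨a, ha, h1⟩ := formGradient_rep_mk Γ hv
  obtain ⟨b, hb, h2⟩ := formGradient_rep_mk Δ hv
  rw [TransversalAt, contains_mk_iff, contains_mk_iff, h1, h2,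
    linearIndependent_pair_smul_iff ha hb]

/-- The preimage of a curve under a linear change of coordinates. -/
def pull (g : CoordChange) (Γ : PlaneCurve d) : PlaneCurve d :=
  ofForm (substForm g (form Γ)) (isHomogeneous_substForm g (isHomogeneous_form Γ))
    ((map_ne_zero_iff _ (substForm_injective g)).2 (form_ne_zero Γ))

theorem exists_form_pull (g : CoordChange) (Γ : PlaneCurve d) :
    ∃ c : ℂ, c ≠ 0 ∧ form (pull g Γ) = c • substForm g (form Γ) :=
  exists_form_ofForm _ _ _

theorem pull_pull (g h : CoordChange) (Γ : PlaneCurve d) : pull h (pull g Γ) = pull (g * h) Γ := by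
  obtain ⟨a, ha, h1⟩ := exists_form_pull g Γ
  obtain ⟨b, hb, h2⟩ := exists_form_pull h (pull g Γ)
  obtain ⟨c, hc, h3⟩ := exists_form_pull (g * h) Γ
  apply ext_form (c := b * a * c⁻¹)
  rw [h2, h1, h3, map_smul, substForm_substForm, smul_smul, smul_smul, mul_assoc,
    inv_mul_cancel₀ hc, mul_one]

theorem pull_one (Γ : PlaneCurve d) : pull 1 Γ = Γ := by
  obtain ⟨a, ha, h1⟩ := exists_form_pull 1 Γ
  rw [substForm_one] at h1
  exact ext_form h1

theorem pull_inv_pull (g : CoordChange) (Γ : PlaneCurve d) : pull g⁻¹ (pull g Γ) = Γ := by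
  rw [pull_pull, mul_inv_cancel, pull_one]

theorem pull_pull_inv (g : CoordChange) (Γ : PlaneCurve d) : pull g (pull g⁻¹ Γ) = Γ := by
  rw [pull_pull, inv_mul_cancel, pull_one]

theorem pull_injective (g : CoordChange) : Function.Injective (pull (d := d) g) :=
  Function.LeftInverse.injective (pull_inv_pull g)

theorem contains_pull (g : CoordChange) (Γ : PlaneCurve d) (P : ProjPlane) :
    Contains (pull g Γ) P ↔ Contains Γ (g • P) := by
  induction P using Projectivization.ind with
  | h v hv =>
    obtain ⟨c, hc, h⟩ := exists_form_pull g Γ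
    rw [Projectivization.smul_mk, contains_mk_iff, contains_mk_iff, h, smul_eval, eval_substForm]
    simp [hc]

/-- A linear relation between the gradients is preserved by a change of coordinates, because the
gradient is transformed by the transposed matrix, which is invertible. -/
theorem formGradient_substForm_comb (g : CoordChange) (F G : MvPolynomial (Fin 3) ℂ)
    (v : Fin 3 → ℂ) (s t : ℂ) :
    s • formGradient (substForm g F) v + t • formGradient (substForm g G) v = 0 ↔
      s • formGradient F (g v) + t • formGradient G (g v) = 0 := by
  constructor
  · intro h
    refine dotProduct_eq_zero _ fun w => ?_
    have := congrArg (fun u => u ⬝ᵥ g⁻¹ w) h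
    simp only [add_dotProduct, smul_dotProduct, formGradient_substForm_dotProduct,
      zero_dotProduct] at this
    rw [← LinearEquiv.mul_apply, mul_inv_cancel, LinearEquiv.coe_one, id] at this
    simpa only [add_dotProduct, smul_dotProduct] using this
  · intro h
    refine dotProduct_eq_zero _ fun w => ?_
    have := congrArg (fun u => u ⬝ᵥ g w) h
    simpa only [add_dotProduct, smul_dotProduct, formGradient_substForm_dotProduct,
      zero_dotProduct] using this

theorem transversalAt_pull (g : CoordChange) (Γ : PlaneCurve d) (Δ : PlaneCurve e)
    (P : ProjPlane) :
    TransversalAt (pull g Γ) (pull g Δ) P ↔ TransversalAt Γ Δ (g • P) := by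
  have hc := contains_pull g Γ P
  have hc' := contains_pull g Δ P
  induction P using Projectivization.ind with
  | h v hv =>
    obtain ⟨a, ha, h1⟩ := exists_form_pull g Γ
    obtain ⟨b, hb, h2⟩ := exists_form_pull g Δ
    rw [Projectivization.smul_mk] at *
    rw [contains_mk_iff, contains_mk_iff] at hc hc'
    rw [transversalAt_mk_iff, transversalAt_mk_iff, hc, hc', h1, h2, formGradient_smul,
      formGradient_smul, linearIndependent_pair_smul_iff ha hb, LinearIndependent.pair_iff,
      LinearIndependent.pair_iff]
    simp only [formGradient_substForm_comb]
    rfl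

theorem isSmooth_iff (Γ : PlaneCurve d) :
    IsSmooth Γ ↔ ∀ v : Fin 3 → ℂ, v ≠ 0 → eval v (form Γ) = 0 → formGradient (form Γ) v ≠ 0 := by
  constructor
  · intro h v hv hev h0
    obtain ⟨c, -, hg⟩ := formGradient_rep_mk Γ hv
    exact h _ ((contains_mk_iff Γ hv).2 hev) (by rw [hg, h0, smul_zero])
  · intro h P hP
    exact h _ P.rep_nonzero hP

theorem isSmooth_pull (g : CoordChange) {Γ : PlaneCurve d} (hΓ : IsSmooth Γ) :
    IsSmooth (pull g Γ) := by
  rw [isSmooth_iff] at hΓ ⊢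
  intro v hv hev h0
  obtain ⟨a, ha, h1⟩ := exists_form_pull g Γ
  rw [h1, smul_eval, eval_substForm] at hev
  rw [h1, formGradient_smul, smul_eq_zero_iff_right ha] at h0
  refine hΓ (g v) ((map_ne_zero_iff _ g.injective).2 hv) (by simpa [ha] using hev) ?_
  have := (formGradient_substForm_comb g (form Γ) 0 v 1 0).1 (by simpa using h0)
  simpa using this

end PlaneCurve


theorem arrangementMult_image_pull {d : ℕ} (g : CoordChange) (A : Set (PlaneCurve d))
    (P : ProjPlane) : arrangementMult (pull g '' A) P = arrangementMult A (g • P) := by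
  have : curvesThrough (pull g '' A) P = pull g '' curvesThrough A (g • P) := by
    ext Γ
    constructor
    · rintro ⟨⟨Δ, hΔ, rfl⟩, h⟩
      exact ⟨Δ, ⟨hΔ, (contains_pull g Δ P).1 h⟩, rfl⟩
    · rintro ⟨Δ, ⟨hΔ, h⟩, rfl⟩
      exact ⟨⟨Δ, hΔ, rfl⟩, (contains_pull g Δ P).2 h⟩
  rw [arrangementMult, this, (pull_injective g).encard_image, arrangementMult]

/-- The smooth conics that divide some polar of the form `F`. -/
def conicsOf (F : MvPolynomial (Fin 3) ℂ) : Set (PlaneCurve 2) :=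
  {Q | IsSmooth Q ∧ ∃ p : Fin 3 → ℂ, p ≠ 0 ∧ form Q ∣ polarForm F p}

theorem dvd_smul_iff {F G : MvPolynomial (Fin 3) ℂ} {c : ℂ} (hc : c ≠ 0) : F ∣ c • G ↔ F ∣ G := by
  rw [smul_eq_C_mul]
  exact ((isUnit_iff_ne_zero.2 hc).map C).dvd_mul_left

theorem smul_dvd_iff {F G : MvPolynomial (Fin 3) ℂ} {c : ℂ} (hc : c ≠ 0) : c • F ∣ G ↔ F ∣ G := by
  rw [smul_eq_C_mul]
  exact ((isUnit_iff_ne_zero.2 hc).map C).mul_left_dvd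

/-- The conics of a quartic do not depend on the equation chosen. -/
theorem conicsOf_smul (F : MvPolynomial (Fin 3) ℂ) {c : ℂ} (hc : c ≠ 0) :
    conicsOf (c • F) = conicsOf F := by
  simp only [conicsOf, polarForm_smul_form, dvd_smul_iff hc]

theorem form_pull_dvd_polarForm_iff (g : CoordChange) (F : MvPolynomial (Fin 3) ℂ)
    (Q : PlaneCurve 2) (p : Fin 3 → ℂ) :
    form (pull g Q) ∣ polarForm (substForm g F) p ↔ form Q ∣ polarForm F (g p) := by
  obtain ⟨c, hc, h⟩ := exists_form_pull g Q
  rw [h, smul_dvd_iff hc, polarForm_substForm]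
  refine ⟨fun h => ?_, fun h => map_dvd _ h⟩
  have := map_dvd (substForm g⁻¹) h
  rwa [substForm_substForm, substForm_substForm, mul_inv_cancel, substForm_one, substForm_one]
    at this

/-- The arrangement of conics is equivariant under linear changes of coordinates. -/
theorem image_pull_conicsOf (g : CoordChange) (F : MvPolynomial (Fin 3) ℂ) :
    pull g '' conicsOf F = conicsOf (substForm g F) := by
  ext Q
  constructor
  · rintro ⟨Q, ⟨hQ, p, hp, h⟩, rfl⟩
    refine ⟨isSmooth_pull g hQ, g⁻¹ p, (map_ne_zero_iff _ g⁻¹.injective).2 hp, ?_⟩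
    rwa [form_pull_dvd_polarForm_iff, ← LinearEquiv.mul_apply, mul_inv_cancel,
      LinearEquiv.coe_one, id]
  · rintro ⟨hQ, p, hp, h⟩
    refine ⟨pull g⁻¹ Q, ⟨isSmooth_pull _ hQ, g p, (map_ne_zero_iff _ g.injective).2 hp, ?_⟩,
      pull_pull_inv g Q⟩
    rwa [← form_pull_dvd_polarForm_iff, pull_pull_inv]

/-! ### Factors of forms -/

section Factors

/-- The substitution `Xᵢ ↦ Xᵢ T`; the coefficient of `Tᵏ` is the homogeneous component of
degree `k`. -/
def gradingHom : MvPolynomial (Fin 3) ℂ →ₐ[ℂ] Polynomial (MvPolynomial (Fin 3) ℂ) :=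
  aeval fun i => Polynomial.C (X i) * Polynomial.X

theorem coeff_gradingHom (F : MvPolynomial (Fin 3) ℂ) (k : ℕ) :
    (gradingHom F).coeff k = homogeneousComponent k F := by
  induction F using MvPolynomial.induction_on' with
  | monomial m c =>
    have h : gradingHom (monomial m c) =
        Polynomial.C (monomial m c) * Polynomial.X ^ m.degree := by
      rw [gradingHom, aeval_monomial, monomial_eq, Finsupp.degree]
      simp only [Finsupp.prod, mul_pow, Finset.prod_mul_distrib, Finset.prod_pow_eq_pow_sum,
        map_mul, map_prod, map_pow, mul_assoc]
      rfl
    rw [h, Polynomial.coeff_C_mul_X_pow]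
    split_ifs with hk
    · rw [hk, homogeneousComponent_of_mem (isHomogeneous_monomial c rfl), if_pos rfl]
    · rw [homogeneousComponent_of_mem (isHomogeneous_monomial c rfl), if_neg hk]
  | add p q hp hq => rw [map_add, Polynomial.coeff_add, hp, hq, map_add]

/-- The factors of a nonzero form are forms. -/
theorem exists_isHomogeneous_of_mul {A B : MvPolynomial (Fin 3) ℂ} {n : ℕ}
    (h : (A * B).IsHomogeneous n) (h0 : A * B ≠ 0) :
    ∃ a b, a + b = n ∧ A.IsHomogeneous a ∧ B.IsHomogeneous b := by
  have hA : A ≠ 0 := left_ne_zero_of_mul h0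
  have hB : B ≠ 0 := right_ne_zero_of_mul h0
  have hinj : ∀ {F : MvPolynomial (Fin 3) ℂ}, F ≠ 0 → gradingHom F ≠ 0 := by
    intro F hF hz
    apply hF
    rw [← sum_homogeneousComponent F]
    exact Finset.sum_eq_zero fun k _ => by rw [← coeff_gradingHom, hz, Polynomial.coeff_zero]
  have hmul : gradingHom A * gradingHom B = Polynomial.C (A * B) * Polynomial.X ^ n := by
    rw [← map_mul]
    ext1 k
    rw [coeff_gradingHom, Polynomial.coeff_C_mul_X_pow, homogeneousComponent_of_mem h]
  have h1 := congrArg Polynomial.natDegree hmul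
  have h2 := congrArg Polynomial.natTrailingDegree hmul
  rw [Polynomial.natDegree_mul (hinj hA) (hinj hB), Polynomial.natDegree_C_mul_X_pow n _ h0] at h1
  rw [Polynomial.natTrailingDegree_mul (hinj hA) (hinj hB), Polynomial.C_mul_X_pow_eq_monomial,
    Polynomial.natTrailingDegree_monomial h0] at h2
  have h3 := Polynomial.natTrailingDegree_le_natDegree (gradingHom A)
  have h4 := Polynomial.natTrailingDegree_le_natDegree (gradingHom B)
  have key : ∀ {F : MvPolynomial (Fin 3) ℂ},
      (gradingHom F).natTrailingDegree = (gradingHom F).natDegree →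
      F.IsHomogeneous (gradingHom F).natDegree := by
    intro F hF m hm
    have hc : (gradingHom F).coeff m.degree ≠ 0 := fun hz => hm (by
      have := coeff_homogeneousComponent m.degree F m
      rw [← coeff_gradingHom, hz, if_pos rfl, coeff_zero] at this
      exact this.symm)
    have h5 := Polynomial.le_natDegree_of_ne_zero hc
    have h6 := Polynomial.natTrailingDegree_le_of_ne_zero hc
    have h7 : m.degree = (gradingHom F).natDegree := by omega
    rw [← h7, Finsupp.degree_eq_weight_one]
    rfl
  exact ⟨_, _, h1, key (by omega), key (by omega)⟩

theorem exists_eq_C_of_isHomogeneous_zero {F : MvPolynomial (Fin 3) ℂ} (hF : F.IsHomogeneous 0) :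
    ∃ c, F = C c := by
  have := (totalDegree_zero_iff_isHomogeneous (p := F)).2 hF
  exact ⟨_, totalDegree_eq_zero_iff_eq_C.1 this⟩

theorem isUnit_of_isHomogeneous_zero {F : MvPolynomial (Fin 3) ℂ} (hF : F.IsHomogeneous 0)
    (h0 : F ≠ 0) : IsUnit F := by
  obtain ⟨c, rfl⟩ := exists_eq_C_of_isHomogeneous_zero hF
  exact (isUnit_iff_ne_zero.2 fun hc => h0 (by rw [hc, C_0])).map C

/-- A linear form is given by its gradient, by Euler's identity. -/
theorem exists_linear_coeffs {F : MvPolynomial (Fin 3) ℂ} (hF : F.IsHomogeneous 1) :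
    ∃ u : Fin 3 → ℂ, ∀ v, eval v F = u ⬝ᵥ v := by
  have h : ∀ i, ∃ c, pderiv i F = C c := fun i => exists_eq_C_of_isHomogeneous_zero hF.pderiv
  choose u hu using h
  refine ⟨u, fun v => ?_⟩
  have := congrArg (eval v) hF.sum_X_mul_pderiv
  simp only [hu, map_sum, map_mul, eval_X, eval_C, one_smul] at this
  rw [← this, dotProduct]
  exact Finset.sum_congr rfl fun i _ => mul_comm _ _

/-- The quadratic form with given coefficients of `x², y², z², yz, xz, xy`. -/
def conicForm (a b c d e f : ℂ) : MvPolynomial (Fin 3) ℂ :=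
  C a * X 0 ^ 2 + C b * X 1 ^ 2 + C c * X 2 ^ 2 + C d * (X 1 * X 2) + C e * (X 0 * X 2)
    + C f * (X 0 * X 1)

theorem eval_conicForm (a b c d e f : ℂ) (v : Fin 3 → ℂ) :
    eval v (conicForm a b c d e f) = a * v 0 ^ 2 + b * v 1 ^ 2 + c * v 2 ^ 2 + d * (v 1 * v 2)
      + e * (v 0 * v 2) + f * (v 0 * v 1) := by
  simp [conicForm]

theorem formGradient_conicForm (a b c d e f : ℂ) (v : Fin 3 → ℂ) :
    formGradient (conicForm a b c d e f) v =
      ![2 * a * v 0 + e * v 2 + f * v 1, 2 * b * v 1 + d * v 2 + f * v 0,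
        2 * c * v 2 + d * v 1 + e * v 0] := by
  ext i
  fin_cases i <;>
    simp [formGradient, conicForm, pderiv_X, Derivation.leibniz, Derivation.leibniz_pow] <;> ring

theorem isHomogeneous_conicForm (a b c d e f : ℂ) : (conicForm a b c d e f).IsHomogeneous 2 := by
  have hX : ∀ (r : ℂ) (i : Fin 3), (C r * X i ^ 2 : MvPolynomial (Fin 3) ℂ).IsHomogeneous 2 :=
    fun r i => isHomogeneous_C_mul_X_pow r i 2
  have hXX : ∀ (r : ℂ) (i j : Fin 3),
      (C r * (X i * X j) : MvPolynomial (Fin 3) ℂ).IsHomogeneous 2 := fun r i j =>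
    ((isHomogeneous_X ℂ i).mul (isHomogeneous_X ℂ j)).C_mul r
  exact (((((hX a 0).add (hX b 1)).add (hX c 2)).add (hXX d 1 2)).add (hXX e 0 2)).add (hXX f 0 1)

theorem exists_eq_conicForm {F : MvPolynomial (Fin 3) ℂ} (hF : F.IsHomogeneous 2) :
    ∃ a b c d e f, F = conicForm a b c d e f := by
  have h : ∀ i, ∃ u : Fin 3 → ℂ, ∀ v, eval v (pderiv i F) = u ⬝ᵥ v :=
    fun i => exists_linear_coeffs hF.pderiv
  choose u hu using h
  refine ⟨u 0 0 / 2, u 1 1 / 2, u 2 2 / 2, (u 1 2 + u 2 1) / 2, (u 0 2 + u 2 0) / 2,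
    (u 0 1 + u 1 0) / 2, MvPolynomial.funext fun v => ?_⟩
  have := congrArg (eval v) hF.sum_X_mul_pderiv
  simp only [map_add, map_mul, eval_X, hu, dotProduct, Fin.sum_univ_three,
    nsmul_eq_mul, Nat.cast_ofNat, map_ofNat] at this
  rw [eval_conicForm]
  linear_combination (-1 / 2 : ℂ) * this

/-- The equation of a smooth conic is irreducible: two lines always meet, and their union is
singular at the common point. -/
theorem prime_form_of_isSmooth {Q : PlaneCurve 2} (hQ : IsSmooth Q) : Prime (form Q) := by
  rw [← irreducible_iff_prime]
  have hhom := isHomogeneous_form Q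
  have h0 := form_ne_zero Q
  rw [isSmooth_iff] at hQ
  refine ⟨fun hu => ?_, fun A B hAB => ?_⟩
  · have h1 : totalDegree (form Q) = 0 := by
      obtain ⟨c, -, hc⟩ := (isUnit_iff_eq_C_of_isReduced).1 hu
      rw [hc, totalDegree_C]
    rw [hhom.totalDegree h0] at h1
    omega
  · rw [hAB] at hhom h0
    obtain ⟨a, b, hab, hA, hB⟩ := exists_isHomogeneous_of_mul hhom h0
    by_contra! hcon
    have ha : a ≠ 0 := fun h => hcon.1
      (isUnit_of_isHomogeneous_zero (h ▸ hA) (left_ne_zero_of_mul h0))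
    have hb : b ≠ 0 := fun h => hcon.2
      (isUnit_of_isHomogeneous_zero (h ▸ hB) (right_ne_zero_of_mul h0))
    obtain rfl : a = 1 := by omega
    obtain rfl : b = 1 := by omega
    obtain ⟨u, hu⟩ := exists_linear_coeffs hA
    obtain ⟨w, hw⟩ := exists_linear_coeffs hB
    obtain ⟨v, hv, hv0⟩ : ∃ v ∈ LinearMap.ker (Matrix.mulVecLin (Matrix.of ![u, w])), v ≠ 0 := by
      refine (Submodule.ne_bot_iff _).1 (LinearMap.ker_ne_bot_of_finrank_lt ?_)
      simp
    have hv' : (Matrix.of ![u, w]).mulVec v = 0 := by simpa using hv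
    have h1 : eval v A = 0 := by rw [hu]; simpa [Matrix.mulVec] using congrFun hv' 0
    have h2 : eval v B = 0 := by rw [hw]; simpa [Matrix.mulVec] using congrFun hv' 1
    refine hQ v hv0 (by rw [hAB, map_mul, h1, zero_mul]) ?_
    ext i
    simp [formGradient, hAB, Derivation.leibniz, h1, h2]

/-- A reducible cubic form has a linear factor. -/
theorem exists_line_of_cubic_eq_mul {A B : MvPolynomial (Fin 3) ℂ} (h : (A * B).IsHomogeneous 3)
    (h0 : A * B ≠ 0) (hA : ¬ IsUnit A) (hB : ¬ IsUnit B) :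
    ∃ u : Fin 3 → ℂ, u ≠ 0 ∧ ∀ v, u ⬝ᵥ v = 0 → eval v (A * B) = 0 := by
  obtain ⟨a, b, hab, hA', hB'⟩ := exists_isHomogeneous_of_mul h h0
  have ha : a ≠ 0 := fun h => hA (isUnit_of_isHomogeneous_zero (h ▸ hA') (left_ne_zero_of_mul h0))
  have hb : b ≠ 0 := fun h => hB (isUnit_of_isHomogeneous_zero (h ▸ hB') (right_ne_zero_of_mul h0))
  have hne : ∀ {F : MvPolynomial (Fin 3) ℂ} {u : Fin 3 → ℂ}, F ≠ 0 →
      (∀ v, eval v F = u ⬝ᵥ v) → u ≠ 0 := by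
    rintro F u hF hu rfl
    exact hF (MvPolynomial.funext fun v => by rw [hu, zero_dotProduct, map_zero])
  rcases (by omega : a = 1 ∨ b = 1) with rfl | rfl
  · obtain ⟨u, hu⟩ := exists_linear_coeffs hA'
    exact ⟨u, hne (left_ne_zero_of_mul h0) hu, fun v hv => by rw [map_mul, hu, hv, zero_mul]⟩
  · obtain ⟨u, hu⟩ := exists_linear_coeffs hB'
    exact ⟨u, hne (right_ne_zero_of_mul h0) hu, fun v hv => by rw [map_mul, hu, hv, mul_zero]⟩

/-- A cubic contains at most one smooth conic. -/
theorem eq_of_isSmooth_of_dvd {Q Q' : PlaneCurve 2} (hQ : IsSmooth Q)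
    {F : MvPolynomial (Fin 3) ℂ} (hF : F.IsHomogeneous 3) (h0 : F ≠ 0) (h : form Q ∣ F)
    (h' : form Q' ∣ F) : Q' = Q := by
  obtain ⟨L, rfl⟩ := h'
  rcases (prime_form_of_isSmooth hQ).dvd_or_dvd h with ⟨L', hL⟩ | ⟨L', hL⟩
  · have hh := isHomogeneous_form Q'
    have hne := form_ne_zero Q'
    rw [hL] at hh hne
    obtain ⟨a, b, hab, h1, h2⟩ := exists_isHomogeneous_of_mul hh hne
    have := h1.inj_right (isHomogeneous_form Q) (form_ne_zero Q)
    obtain rfl : b = 0 := by omega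
    obtain ⟨c, rfl⟩ := exists_eq_C_of_isHomogeneous_zero h2
    exact ext_form (c := c) (by rw [hL, smul_eq_C_mul, mul_comm])
  · obtain ⟨a, b, hab, h1, h2⟩ := exists_isHomogeneous_of_mul hF h0
    have ha := h1.inj_right (isHomogeneous_form Q') (form_ne_zero Q')
    have hne := right_ne_zero_of_mul h0
    rw [hL] at h2 hne
    obtain ⟨a', b', hab', h1', h2'⟩ := exists_isHomogeneous_of_mul h2 hne
    have := h1'.inj_right (isHomogeneous_form Q) (form_ne_zero Q)
    omega

/-- A cubic with a conic as a component is reducible. -/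
theorem exists_mul_of_conic_dvd {Q : PlaneCurve 2} {F : MvPolynomial (Fin 3) ℂ}
    (hQ : IsSmooth Q) (hF : F.IsHomogeneous 3) (h0 : F ≠ 0) (h : form Q ∣ F) :
    ∃ A B : MvPolynomial (Fin 3) ℂ, ¬ IsUnit A ∧ ¬ IsUnit B ∧ F = A * B := by
  obtain ⟨L, rfl⟩ := h
  refine ⟨_, L, (prime_form_of_isSmooth hQ).not_isUnit, fun hu => ?_, rfl⟩
  obtain ⟨c, hc, rfl⟩ := (isUnit_iff_eq_C_of_isReduced).1 hu
  have h1 : (form Q * C c).IsHomogeneous 2 := by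
    simpa using (isHomogeneous_form Q).mul (isHomogeneous_C (Fin 3) c)
  have := h1.inj_right hF h0
  omega

end Factors

theorem isHomogeneous_polarForm {F : MvPolynomial (Fin 3) ℂ} {d : ℕ} (hF : F.IsHomogeneous d)
    (p : Fin 3 → ℂ) : (polarForm F p).IsHomogeneous (d - 1) :=
  IsHomogeneous.sum _ _ _ fun i _ => (hF.pderiv).C_mul (p i)

/-! ### The reducible polars of the Klein quartic -/

theorem isHomogeneous_kleinQuartic : kleinQuartic.IsHomogeneous 4 := by
  have h : ∀ i j : Fin 3, (X i ^ 3 * X j : MvPolynomial (Fin 3) ℂ).IsHomogeneous 4 := fun i j =>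
    (isHomogeneous_X_pow i 3).mul (isHomogeneous_X ℂ j)
  exact ((h 0 1).add (h 1 2)).add (h 2 0)

theorem eval_kleinQuartic (v : Fin 3 → ℂ) :
    eval v kleinQuartic = v 0 ^ 3 * v 1 + v 1 ^ 3 * v 2 + v 2 ^ 3 * v 0 := by
  simp [kleinQuartic]

theorem eval_polarForm_kleinQuartic (p v : Fin 3 → ℂ) :
    eval v (polarForm kleinQuartic p) = p 0 * (3 * v 0 ^ 2 * v 1 + v 2 ^ 3)
      + p 1 * (v 0 ^ 3 + 3 * v 1 ^ 2 * v 2) + p 2 * (v 1 ^ 3 + 3 * v 2 ^ 2 * v 0) := by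
  rw [eval_polarForm, Fin.sum_univ_three]
  simp [formGradient, kleinQuartic, pderiv_X, Derivation.leibniz, Derivation.leibniz_pow]
  ring

theorem polarForm_kleinQuartic_injective {p q : Fin 3 → ℂ}
    (h : polarForm kleinQuartic p = polarForm kleinQuartic q) : p = q := by
  have key : ∀ v, _ := fun v => congrArg (eval v) h
  simp only [eval_polarForm_kleinQuartic] at key
  have h0 := key ![0, 0, 1]
  have h1 := key ![1, 0, 0]
  have h2 := key ![0, 1, 0]
  ext i
  fin_cases i
  · simpa using h0
  · simpa using h1
  · simpa using h2

theorem polarForm_kleinQuartic_ne_zero {p : Fin 3 → ℂ} (hp : p ≠ 0) :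
    polarForm kleinQuartic p ≠ 0 := fun h =>
  hp (polarForm_kleinQuartic_injective (h.trans (by simp [polarForm])))

/-- The polars that contain a line. A point on the line `z = m x + n y` is substituted into the
cubic, and the vanishing of the four coefficients is solved in terms of `w = m² n`, which is
invariant under the symmetry of order seven of the Klein quartic. -/
theorem exists_params_of_line {p u : Fin 3 → ℂ} (hp : p ≠ 0) (hu : u ≠ 0)
    (h : ∀ v, u ⬝ᵥ v = 0 → eval v (polarForm kleinQuartic p) = 0) :
    ∃ w m s : ℂ, w ^ 3 - w ^ 2 - 9 * w + 1 = 0 ∧ (1 - 8 * w - 3 * w ^ 2) * m ^ 7 = 2 * w ^ 4 ∧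
      w ≠ 0 ∧ p = s • ![2 * w, m ^ 3 * (3 + w), -(m * (1 + w))] := by
  have hcoord : ∀ {q : Fin 3 → ℂ}, q 0 = 0 → q 1 = 0 → q 2 = 0 → q = 0 := by
    intro q h0 h1 h2
    ext i
    fin_cases i <;> assumption
  have hline : ∀ x y z, u 0 * x + u 1 * y + u 2 * z = 0 → p 0 * (3 * x ^ 2 * y + z ^ 3)
      + p 1 * (x ^ 3 + 3 * y ^ 2 * z) + p 2 * (y ^ 3 + 3 * z ^ 2 * x) = 0 := by
    intro x y z hxyz
    have := h ![x, y, z] (by simpa [dotProduct, Fin.sum_univ_three] using hxyz)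
    rw [eval_polarForm_kleinQuartic] at this
    simpa using this
  set a := p 0 with ha
  set b := p 1 with hb
  set c := p 2 with hc
  have hu2 : u 2 ≠ 0 := by
    intro h2
    have ha0 : a = 0 := by
      have := hline 0 0 1 (by simp [h2])
      linear_combination this
    have key : ∀ t : ℂ, b * (u 1 ^ 3 + 3 * u 0 ^ 2 * t) + c * (-u 0 ^ 3 + 3 * t ^ 2 * u 1) = 0 := by
      intro t
      have := hline (u 1) (-u 0) t (by rw [h2]; ring)
      rw [ha0] at this
      linear_combination this
    have k0 := key 0
    have k1 := key 1
    have k2 := key (-1)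
    have hc1 : c * u 1 = 0 := by linear_combination (k1 + k2 - 2 * k0) / 6
    have hb0 : b * u 0 ^ 2 = 0 := by linear_combination (k1 - k2) / 6
    rcases mul_eq_zero.1 hc1 with hc0 | hu1
    · rcases mul_eq_zero.1 hb0 with hb0 | hu0
      · exact hp (hcoord ha0 hb0 hc0)
      · have hu0 : u 0 = 0 := by simpa using hu0
        have hu1 : u 1 ≠ 0 := fun hu1 => hu (hcoord hu0 hu1 h2)
        refine hp (hcoord ha0 ?_ hc0)
        simpa [hc0, hu0, hu1] using k0
    · have hu0 : u 0 ≠ 0 := fun hu0 => hu (hcoord hu0 hu1 h2)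
      have hb0 : b = 0 := by simpa [hu0] using hb0
      refine hp (hcoord ha0 hb0 ?_)
      simpa [hb0, hu0, hu1] using k0
  obtain ⟨m, hm⟩ : ∃ m, m = -u 0 / u 2 := ⟨_, rfl⟩
  obtain ⟨n, hn⟩ : ∃ n, n = -u 1 / u 2 := ⟨_, rfl⟩
  have key : ∀ x y, a * (3 * x ^ 2 * y + (m * x + n * y) ^ 3)
      + b * (x ^ 3 + 3 * y ^ 2 * (m * x + n * y)) + c * (y ^ 3 + 3 * (m * x + n * y) ^ 2 * x) = 0 :=
    fun x y => hline x y (m * x + n * y) (by rw [hm, hn]; field_simp; ring)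
  have e1 : a * m ^ 3 + b + 3 * c * m ^ 2 = 0 := by linear_combination key 1 0
  have e4 : a * n ^ 3 + 3 * b * n + c = 0 := by linear_combination key 0 1
  have k1 := key 1 1
  have k2 := key 1 (-1)
  have e2 : a * (1 + m ^ 2 * n) + 2 * c * m * n = 0 := by
    linear_combination (k1 - k2) / 6 - e4 / 3
  have e3 : a * m * n ^ 2 + b * m + c * n ^ 2 = 0 := by
    linear_combination (k1 + k2) / 6 - e1 / 3
  have ha0 : a ≠ 0 := by
    intro ha0
    have hcmn : c * m * n = 0 := by linear_combination e2 / 2 - ha0 * (1 + m ^ 2 * n) / 2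
    have hc0 : c = 0 := by
      linear_combination e4 - 3 * n * e1 + 9 * m * hcmn + ha0 * (3 * n * m ^ 3 - n ^ 3)
    exact hp (hcoord ha0 (by linear_combination e1 - m ^ 3 * ha0 - 3 * m ^ 2 * hc0) hc0)
  have hmn : m * n ≠ 0 := by
    intro hmn
    exact ha0 (by linear_combination e2 - (a * m + 2 * c) * hmn)
  have hm0 : m ≠ 0 := left_ne_zero_of_mul hmn
  have hn0 : n ≠ 0 := right_ne_zero_of_mul hmn
  obtain ⟨w, hw⟩ : ∃ w, w = m ^ 2 * n := ⟨_, rfl⟩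
  have hw0 : w ≠ 0 := by rw [hw]; positivity
  have hnw : n = w / m ^ 2 := by rw [hw]; field_simp
  have hcw : 2 * w * c = -(a * m * (1 + w)) := by rw [hw]; linear_combination m * e2
  have hbw : 2 * w * b = a * m ^ 3 * (3 + w) := by
    linear_combination 2 * w * e1 - 3 * m ^ 2 * hcw
  have f3 : m ^ 7 * (3 + w) = w ^ 2 - w ^ 3 := by
    have : a * (m ^ 7 * (3 + w) - (w ^ 2 - w ^ 3)) = 0 := by
      have h' : m ^ 2 * n = w := hw.symm
      linear_combination (2 * w * m ^ 3) * e3 - m ^ 4 * hbw - m ^ 3 * n ^ 2 * hcw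
        - (a * (2 * w - (1 + w)) * (m ^ 2 * n + w)) * h'
    exact sub_eq_zero.1 ((mul_eq_zero.1 this).resolve_left ha0)
  have f4 : (1 - 8 * w - 3 * w ^ 2) * m ^ 7 = 2 * w ^ 4 := by
    have : a * m ^ 7 * (1 - 8 * w - 3 * w ^ 2) - a * (2 * w ^ 4) = 0 := by
      have h' : m ^ 2 * n = w := hw.symm
      linear_combination (-2 * w * m ^ 6) * e4 + (3 * m ^ 6 * n) * hbw + m ^ 6 * hcw
        + (a * 2 * w * ((m ^ 2 * n) ^ 2 + (m ^ 2 * n) * w + w ^ 2)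
          + 3 * a * m ^ 7 * (3 + w)) * h'
    have h2 : a * ((1 - 8 * w - 3 * w ^ 2) * m ^ 7 - 2 * w ^ 4) = 0 := by linear_combination this
    exact sub_eq_zero.1 ((mul_eq_zero.1 h2).resolve_left ha0)
  refine ⟨w, m, a / (2 * w), ?_, f4, hw0, ?_⟩
  · have : w ^ 2 * (w ^ 3 - w ^ 2 - 9 * w + 1) = 0 := by
      linear_combination (3 + w) * f4 - (1 - 8 * w - 3 * w ^ 2) * f3
    exact (mul_eq_zero.1 this).resolve_left (pow_ne_zero 2 hw0)
  · ext i
    fin_cases i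
    · change a = a / (2 * w) * (2 * w)
      field_simp
    · change b = a / (2 * w) * (m ^ 3 * (3 + w))
      field_simp
      linear_combination hbw
    · change c = a / (2 * w) * (-(m * (1 + w)))
      field_simp
      linear_combination hcw

/-- The linear map with a given injective matrix, as a change of coordinates. -/
def CoordChange.ofMatrix (A : Matrix (Fin 3) (Fin 3) ℂ) (hA : ∀ v, A.mulVec v = 0 → v = 0) :
    CoordChange :=
  LinearEquiv.ofInjectiveEndo A.mulVecLin ((injective_iff_map_eq_zero _).2 hA)

theorem CoordChange.ofMatrix_apply (A : Matrix (Fin 3) (Fin 3) ℂ)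
    (hA : ∀ v, A.mulVec v = 0 → v = 0) (v : Fin 3 → ℂ) :
    CoordChange.ofMatrix A hA v = A.mulVec v := rfl

section SeventhRoot

variable {ζ : ℂ}

theorem IsPrimitiveRoot.cyclotomic_seven (hζ : IsPrimitiveRoot ζ 7) :
    ζ ^ 6 + ζ ^ 5 + ζ ^ 4 + ζ ^ 3 + ζ ^ 2 + ζ + 1 = 0 := by
  have := hζ.geom_sum_eq_zero (by norm_num)
  simp only [Finset.sum_range_succ, Finset.sum_range_zero] at this
  linear_combination this

/-- The centre of an involution of the Klein quartic; its polar is a line and a conic. -/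
def kleinCentre (ζ : ℂ) : Fin 3 → ℂ := ![1, ζ ^ 4 + ζ ^ 5, -(ζ + ζ ^ 2 + ζ ^ 5)]

/-- The elements of the group of order 21 that is generated by `diag(ζ, ζ⁴, ζ²)` and by the cyclic
permutations of the coordinates: the `j`-th power of the former after the `k`-th cyclic shift. -/
def frobeniusChange (hζ : IsPrimitiveRoot ζ 7) (k : Fin 3) (j : Fin 7) : CoordChange :=
  CoordChange.ofMatrix
    (Matrix.of fun i l => if l = i + k then (ζ ^ (j : ℕ)) ^ (![1, 4, 2] i : ℕ) else 0)
    fun v hv => by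
      have h0 : ζ ≠ 0 := hζ.ne_zero (by norm_num)
      ext l
      have := congrFun hv (l - k)
      simpa [Matrix.mulVec, dotProduct, h0] using this

theorem frobeniusChange_apply (hζ : IsPrimitiveRoot ζ 7) (k : Fin 3) (j : Fin 7)
    (v : Fin 3 → ℂ) (i : Fin 3) :
    frobeniusChange hζ k j v i = (ζ ^ (j : ℕ)) ^ (![1, 4, 2] i : ℕ) * v (i + k) := by
  rw [frobeniusChange, CoordChange.ofMatrix_apply]
  simp [Matrix.mulVec, dotProduct]

theorem substForm_frobeniusChange (hζ : IsPrimitiveRoot ζ 7) (k : Fin 3) (j : Fin 7) :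
    substForm (frobeniusChange hζ k j) kleinQuartic = kleinQuartic := by
  refine MvPolynomial.funext fun v => ?_
  rw [eval_substForm, eval_kleinQuartic, eval_kleinQuartic]
  simp only [frobeniusChange_apply]
  have ht : (ζ ^ (j : ℕ)) ^ 7 = 1 := by rw [← pow_mul, mul_comm, pow_mul, hζ.pow_eq_one, one_pow]
  generalize ζ ^ (j : ℕ) = t at ht
  fin_cases k <;> simp <;> grind

/-- The points with reducible polar form one orbit of the group of order 21. -/
theorem exists_eq_frobeniusChange (hζ : IsPrimitiveRoot ζ 7) {p u : Fin 3 → ℂ} (hp : p ≠ 0)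
    (hu : u ≠ 0) (h : ∀ v, u ⬝ᵥ v = 0 → eval v (polarForm kleinQuartic p) = 0) :
    ∃ k j, ∃ s : ℂ, p = s • frobeniusChange hζ k j (kleinCentre ζ) := by
  obtain ⟨w, m, s, hw, hm, hw0, rfl⟩ := exists_params_of_line hp hu h
  have hΦ := hζ.cyclotomic_seven
  have h0 : ζ ≠ 0 := hζ.ne_zero (by norm_num)
  -- the three values of `w` and the corresponding values of `m` for the three cyclic
  -- permutations of the centre
  let W : Fin 3 → ℂ := ![-1 - 2 * (ζ ^ 2 + ζ ^ 3 + ζ ^ 4 + ζ ^ 5), 1 + 2 * ζ ^ 3 + 2 * ζ ^ 4,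
    1 + 2 * ζ ^ 2 + 2 * ζ ^ 5]
  let N : Fin 3 → ℂ := ![-(ζ ^ 4 + ζ ^ 6), -(ζ ^ 2 + ζ ^ 3), -(ζ + ζ ^ 5)]
  have hW : ∃ k, w = W k := by
    have : (w - W 0) * (w - W 1) * (w - W 2) = 0 := by
      simp only [W, Matrix.cons_val]
      grind
    rcases mul_eq_zero.1 this with h | h
    · rcases mul_eq_zero.1 h with h | h
      · exact ⟨0, sub_eq_zero.1 h⟩
      · exact ⟨1, sub_eq_zero.1 h⟩
    · exact ⟨2, sub_eq_zero.1 h⟩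
  obtain ⟨k, rfl⟩ := hW
  have hN : (1 - 8 * W k - 3 * W k ^ 2) * N k ^ 7 = 2 * W k ^ 4 := by
    fin_cases k <;> simp [W, N] <;> grind
  have hN0 : N k ≠ 0 := by
    intro hz
    rw [hz] at hN
    exact hw0 (by simpa using hN.symm)
  have hfac : (1 - 8 * W k - 3 * W k ^ 2) ≠ 0 := by
    intro hz
    rw [hz] at hN
    exact hw0 (by simpa using hN.symm)
  have hroot : (m / N k) ^ 7 = 1 := by
    rw [div_pow, div_eq_one_iff_eq (pow_ne_zero _ hN0)]
    exact mul_left_cancel₀ hfac (hm.trans hN.symm)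
  obtain ⟨j, hj, hjm⟩ := hζ.eq_pow_of_pow_eq_one hroot
  have hm' : m = ζ ^ j * N k := by rw [hjm]; field_simp
  have hP : ∃ r : ℂ, ∀ i : Fin 3, ![2 * W k, N k ^ 3 * (3 + W k), -(N k * (1 + W k))] i
      = r * kleinCentre ζ (i + k) := by
    fin_cases k
    · refine ⟨2 * W 0, fun i => ?_⟩
      fin_cases i <;> simp [W, N, kleinCentre] <;> grind
    · refine ⟨-2 - 4 * ζ - 2 * ζ ^ 2 - 2 * ζ ^ 3 - 4 * ζ ^ 4 - 2 * ζ ^ 5, fun i => ?_⟩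
      fin_cases i <;> simp [W, N, kleinCentre] <;> grind
    · refine ⟨-4 + 2 * ζ - 4 * ζ ^ 2 + 2 * ζ ^ 3 - 4 * ζ ^ 4, fun i => ?_⟩
      fin_cases i <;> simp [W, N, kleinCentre] <;> grind
  obtain ⟨r, hr⟩ := hP
  refine ⟨k, ⟨j, hj⟩, s * r / ζ ^ j, ?_⟩
  have hr0 := hr 0
  have hr1 := hr 1
  have hr2 := hr 2
  simp only [Matrix.cons_val, zero_add] at hr0 hr1 hr2
  have hj0 : ζ ^ j ≠ 0 := pow_ne_zero _ h0
  ext i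
  rw [Pi.smul_apply, Pi.smul_apply, frobeniusChange_apply, hm', smul_eq_mul, smul_eq_mul]
  generalize ζ ^ j = t at *
  fin_cases i
  · simp
    field_simp
    linear_combination s * hr0
  · simp
    field_simp
    linear_combination s * hr1
  · simp
    field_simp
    linear_combination s * hr2

/-- The 21 points of the orbit are distinct: the ratio `z³ / (x² y)` tells the cyclic permutations
apart, and then `z / x` the elements of order seven. -/
theorem frobeniusChange_kleinCentre_injective (hζ : IsPrimitiveRoot ζ 7) {k k' : Fin 3}
    {j j' : Fin 7} {s : ℂ} (h : frobeniusChange hζ k j (kleinCentre ζ)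
      = s • frobeniusChange hζ k' j' (kleinCentre ζ)) : k = k' ∧ j = j' := by
  have hΦ := hζ.cyclotomic_seven
  have h0 : ζ ≠ 0 := hζ.ne_zero (by norm_num)
  obtain ⟨b, hb⟩ : ∃ b, b = ζ ^ 4 + ζ ^ 5 := ⟨_, rfl⟩
  obtain ⟨c, hc⟩ : ∃ c, c = -(ζ + ζ ^ 2 + ζ ^ 5) := ⟨_, rfl⟩
  have hb0 : b ≠ 0 := by grind
  have hc0 : c ≠ 0 := by grind
  have hcb : c ^ 4 * b ≠ 1 := by grind
  have hcb' : c ^ 5 ≠ b ^ 4 := by grind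
  have hbc : b ^ 5 ≠ c := by grind
  obtain ⟨q, hq⟩ : ∃ q : Fin 3 → ℂ, q = ![1, b, c] := ⟨_, rfl⟩
  have hcen : kleinCentre ζ = q := by rw [hq, hb, hc, kleinCentre]
  have hq0 : ∀ i, q i ≠ 0 := by
    intro i
    rw [hq]
    fin_cases i <;> simp [hb0, hc0]
  have e0 := congrFun h 0
  have e1 := congrFun h 1
  have e2 := congrFun h 2
  simp only [frobeniusChange_apply, Pi.smul_apply, smul_eq_mul, hcen, Matrix.cons_val,
    pow_one] at e0 e1 e2
  have hj : ζ ^ (j : ℕ) ≠ 0 := pow_ne_zero _ h0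
  have hj' : ζ ^ (j' : ℕ) ≠ 0 := pow_ne_zero _ h0
  have hinj : ζ ^ (j : ℕ) = ζ ^ (j' : ℕ) → j = j' := fun h =>
    Fin.ext (hζ.pow_inj j.2 j'.2 h)
  generalize ζ ^ (j : ℕ) = t at *
  generalize ζ ^ (j' : ℕ) = t' at *
  have hs : s ≠ 0 := by
    rintro rfl
    exact mul_ne_zero hj (hq0 (0 + k)) (by rw [e0, zero_mul])
  have hk : q (2 + k) ^ 3 * (q (0 + k') ^ 2 * q (1 + k'))
      = q (2 + k') ^ 3 * (q (0 + k) ^ 2 * q (1 + k)) := by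
    have h2 : t ^ 6 * q (2 + k) ^ 3 = s ^ 3 * t' ^ 6 * q (2 + k') ^ 3 := by
      linear_combination congrArg (fun x => x ^ 3) e2
    have h1 : t ^ 6 * (q (0 + k) ^ 2 * q (1 + k))
        = s ^ 3 * t' ^ 6 * (q (0 + k') ^ 2 * q (1 + k')) := by
      linear_combination congrArg (fun x => x ^ 2) e0 * (t ^ 4 * q (1 + k))
        + (s * (t' * q (0 + k'))) ^ 2 * e1
    refine mul_left_cancel₀ (mul_ne_zero (pow_ne_zero 6 hj) (mul_ne_zero (pow_ne_zero 3 hs)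
      (pow_ne_zero 6 hj'))) ?_
    linear_combination (s ^ 3 * t' ^ 6 * (q (0 + k') ^ 2 * q (1 + k'))) * h2
      - s ^ 3 * t' ^ 6 * q (2 + k') ^ 3 * h1
  have hkk : k = k' := by
    rw [hq] at hk
    fin_cases k <;> fin_cases k' <;> first | rfl | (exfalso; simp at hk; grind)
  refine ⟨hkk, hinj ?_⟩
  subst hkk
  have h1 : (t * t') * (q (0 + k) * q (2 + k)) * t = (t * t') * (q (0 + k) * q (2 + k)) * t' := by
    refine mul_left_cancel₀ hs ?_
    linear_combination (s * t' * q (0 + k)) * e2 - (s * t' ^ 2 * q (2 + k)) * e0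
  exact mul_left_cancel₀ (mul_ne_zero (mul_ne_zero hj hj')
    (mul_ne_zero (hq0 _) (hq0 _))) h1
end SeventhRoot

/-! ### Smooth conics with given coefficients -/

theorem conicForm_ne_zero {a b c d e f : ℂ}
    (h : 4 * a * b * c + d * e * f - a * d ^ 2 - b * e ^ 2 - c * f ^ 2 ≠ 0) :
    conicForm a b c d e f ≠ 0 := by
  intro h0
  have key : ∀ v, _ := fun v => (eval_conicForm a b c d e f v).symm.trans (congrArg (eval v) h0)
  have k0 := key ![1, 0, 0]
  have k1 := key ![0, 1, 0]
  have k2 := key ![0, 0, 1]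
  have k3 := key ![0, 1, 1]
  simp at k0 k1 k2 k3
  have hd : d = 0 := by linear_combination k3 - k1 - k2
  exact h (by rw [k0, k1, k2, hd]; ring)

/-- The conic with given coefficients of `x², y², z², yz, xz, xy`, and with nonzero discriminant. -/
def conicCurve (a b c d e f : ℂ)
    (h : 4 * a * b * c + d * e * f - a * d ^ 2 - b * e ^ 2 - c * f ^ 2 ≠ 0) : PlaneCurve 2 :=
  ofForm (conicForm a b c d e f) (isHomogeneous_conicForm a b c d e f) (conicForm_ne_zero h)

section conicCurve

variable {a b c d e f : ℂ}
  {h : 4 * a * b * c + d * e * f - a * d ^ 2 - b * e ^ 2 - c * f ^ 2 ≠ 0}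

theorem exists_form_conicCurve :
    ∃ r : ℂ, r ≠ 0 ∧ form (conicCurve a b c d e f h) = r • conicForm a b c d e f :=
  exists_form_ofForm _ _ _

theorem isSmooth_conicCurve : IsSmooth (conicCurve a b c d e f h) := by
  rw [isSmooth_iff]
  intro v hv _ hg
  obtain ⟨r, hr, hform⟩ := exists_form_conicCurve (h := h)
  rw [hform, formGradient_smul, smul_eq_zero_iff_right hr, formGradient_conicForm] at hg
  have g0 := congrFun hg 0
  have g1 := congrFun hg 1
  have g2 := congrFun hg 2
  simp at g0 g1 g2
  -- the adjugate of the symmetric matrix of the conic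
  have k : ∀ t : ℂ, (4 * a * b * c + d * e * f - a * d ^ 2 - b * e ^ 2 - c * f ^ 2) * t = 0 →
      t = 0 := fun t ht => (mul_eq_zero.1 ht).resolve_left h
  apply hv
  ext i
  fin_cases i
  · change v 0 = 0
    refine k _ ?_
    linear_combination ((4 * b * c - d ^ 2) * g0 + (d * e - 2 * c * f) * g1
      + (d * f - 2 * b * e) * g2) / 2
  · change v 1 = 0
    refine k _ ?_
    linear_combination ((d * e - 2 * c * f) * g0 + (4 * a * c - e ^ 2) * g1
      + (e * f - 2 * a * d) * g2) / 2
  · change v 2 = 0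
    refine k _ ?_
    linear_combination ((d * f - 2 * b * e) * g0 + (e * f - 2 * a * d) * g1
      + (4 * a * b - f ^ 2) * g2) / 2

theorem contains_conicCurve {v : Fin 3 → ℂ} (hv : v ≠ 0) :
    Contains (conicCurve a b c d e f h) (Projectivization.mk ℂ v hv) ↔
      a * v 0 ^ 2 + b * v 1 ^ 2 + c * v 2 ^ 2 + d * (v 1 * v 2) + e * (v 0 * v 2)
        + f * (v 0 * v 1) = 0 := by
  rw [conicCurve, contains_ofForm, eval_conicForm]

/-- Equal conics have proportional coefficients. -/
theorem exists_smul_of_conicCurve_eq {a' b' c' d' e' f' : ℂ}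
    {h' : 4 * a' * b' * c' + d' * e' * f' - a' * d' ^ 2 - b' * e' ^ 2 - c' * f' ^ 2 ≠ 0}
    (heq : conicCurve a b c d e f h = conicCurve a' b' c' d' e' f' h') :
    ∃ r : ℂ, a = r * a' ∧ b = r * b' ∧ c = r * c' ∧ d = r * d' ∧ e = r * e' ∧ f = r * f' := by
  obtain ⟨r, hr, hform⟩ := exists_form_conicCurve (h := h)
  obtain ⟨r', hr', hform'⟩ := exists_form_conicCurve (h := h')
  rw [heq, hform'] at hform
  have key : ∀ v, _ := fun v => congrArg (eval v) hform
  simp only [smul_eval, eval_conicForm] at key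
  have k0 := key ![1, 0, 0]
  have k1 := key ![0, 1, 0]
  have k2 := key ![0, 0, 1]
  have k3 := key ![0, 1, 1]
  have k4 := key ![1, 0, 1]
  have k5 := key ![1, 1, 0]
  simp at k0 k1 k2 k3 k4 k5
  refine ⟨r' / r, ?_, ?_, ?_, ?_, ?_, ?_⟩ <;> field_simp
  · linear_combination -k0
  · linear_combination -k1
  · linear_combination -k2
  · linear_combination k1 + k2 - k3
  · linear_combination k0 + k2 - k4
  · linear_combination k0 + k1 - k5

end conicCurve

/-! ### The intersection of a diagonal conic with another conic -/

section Bezout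

variable {α : ℂ}

/-- The discriminant of the conic `2x² + 3α(y² + z²) = 0` is nonzero. -/
theorem discr_baseConic (hα : α ≠ 0) :
    4 * 2 * (3 * α) * (3 * α) + 0 * 0 * 0 - 2 * 0 ^ 2 - 3 * α * 0 ^ 2 - 3 * α * 0 ^ 2 ≠ 0 := by
  have : 72 * α ^ 2 ≠ 0 := by simp [hα]
  intro h
  exact this (by linear_combination h)

/-- The conic `2x² + 3α(y² + z²) = 0`. -/
def baseConic (hα : α ≠ 0) : PlaneCurve 2 :=
  conicCurve 2 (3 * α) (3 * α) 0 0 0 (discr_baseConic hα)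

/-- A rational parametrization of the affine part of the base conic. -/
def baseParam (α t : ℂ) : Fin 3 → ℂ :=
  ![2 * t, t ^ 2 - 2 / (3 * α), Complex.I * (t ^ 2 + 2 / (3 * α))]

/-- The point at infinity of the parametrization `baseParam`. -/
def baseInfty : Fin 3 → ℂ := ![0, 1, Complex.I]

theorem baseParam_ne_zero (hα : α ≠ 0) (t : ℂ) : baseParam α t ≠ 0 := by
  intro h
  have h0 := congrFun h 0
  have h1 := congrFun h 1
  simp [baseParam] at h0 h1
  rw [h0] at h1
  have : (2 : ℂ) / (3 * α) ≠ 0 := by simp [hα]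
  exact this (by linear_combination -h1)

theorem baseInfty_ne_zero : baseInfty ≠ 0 := fun h => by
  have := congrFun h 1
  simp [baseInfty] at this

theorem exists_baseParam (hα : α ≠ 0) {P : ProjPlane} (hP : Contains (baseConic hα) P) :
    P = Projectivization.mk ℂ baseInfty baseInfty_ne_zero ∨
      ∃ t, P = Projectivization.mk ℂ (baseParam α t) (baseParam_ne_zero hα t) := by
  induction P using Projectivization.ind with
  | h v hv =>
    rw [baseConic, contains_conicCurve] at hP
    have hI : Complex.I * Complex.I = -1 := Complex.I_mul_I
    by_cases h : v 1 + Complex.I * v 2 = 0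
    · left
      have hv0 : v 0 = 0 := by
        have : v 0 ^ 2 = 0 := by
          linear_combination hP / 2 - 3 * α / 2 * (v 1 - Complex.I * v 2) * h
            - 3 * α / 2 * v 2 ^ 2 * hI
        simpa using this
      rw [Projectivization.mk_eq_mk_iff']
      refine ⟨v 1, ?_⟩
      ext i
      fin_cases i
      · simp [baseInfty, hv0]
      · simp [baseInfty]
      · simp [baseInfty]
        linear_combination Complex.I * h - v 2 * hI
    · right
      refine ⟨-(2 / (3 * α)) * v 0 / (v 1 + Complex.I * v 2), ?_⟩
      rw [Projectivization.mk_eq_mk_iff']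
      refine ⟨-(3 * α) * (v 1 + Complex.I * v 2) / 4, ?_⟩
      ext i
      fin_cases i
      · simp [baseParam]
        field_simp
        norm_num
      · simp [baseParam]
        field_simp
        linear_combination (-2 : ℂ) * hP + 6 * α * v 2 ^ 2 * hI
      · simp [baseParam]
        field_simp
        linear_combination (-2 * Complex.I) * hP
          - (12 * α * v 1 * v 2 + 6 * Complex.I * α * v 2 ^ 2) * hI

/-- The restriction of a quadratic form to the parametrized conic. -/
def baseRestrict (α a b c d e f : ℂ) : Polynomial ℂ :=
  .C (b - c + d * Complex.I) * .X ^ 4 + .C (2 * (f + e * Complex.I)) * .X ^ 3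
    + .C (4 * a - 4 / (3 * α) * (b + c)) * .X ^ 2
    + .C (4 / (3 * α) * (e * Complex.I - f)) * .X
    + .C ((2 / (3 * α)) ^ 2 * (b - c - d * Complex.I))

theorem eval_baseRestrict (α a b c d e f t : ℂ) :
    (baseRestrict α a b c d e f).eval t = eval (baseParam α t) (conicForm a b c d e f) := by
  rw [eval_conicForm]
  simp only [baseRestrict, baseParam, Polynomial.eval_add, Polynomial.eval_mul, Polynomial.eval_C,
    Polynomial.eval_pow, Polynomial.eval_X, Matrix.cons_val]
  linear_combination (-c * (t ^ 2 + 2 / (3 * α)) ^ 2) * Complex.I_mul_I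

/-- At a point where the gradients are proportional, the restriction has a double root. -/
theorem isRoot_derivative_baseRestrict (hα : α ≠ 0) {a b c d e f t r : ℂ}
    (h : formGradient (conicForm a b c d e f) (baseParam α t)
      = r • formGradient (conicForm 2 (3 * α) (3 * α) 0 0 0) (baseParam α t)) :
    (baseRestrict α a b c d e f).derivative.IsRoot t := by
  have g0 := congrFun h 0
  have g1 := congrFun h 1
  have g2 := congrFun h 2
  simp only [formGradient_conicForm, baseParam, Pi.smul_apply, smul_eq_mul, Matrix.cons_val]
    at g0 g1 g2
  obtain ⟨q, hq⟩ : ∃ q, q = 2 / (3 * α) := ⟨_, rfl⟩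
  have hq' : α * q = 2 / 3 := by rw [hq]; field_simp
  have hq4 : 4 / (3 * α) = 2 * q := by rw [hq]; ring
  rw [← hq] at g0 g1 g2
  rw [baseRestrict, hq4, ← hq]
  simp only [Polynomial.IsRoot, Polynomial.derivative_add, Polynomial.derivative_mul,
    Polynomial.derivative_C, Polynomial.derivative_X_pow, Polynomial.derivative_X,
    Polynomial.eval_add, Polynomial.eval_mul, Polynomial.eval_C, Polynomial.eval_pow,
    Polynomial.eval_X, Polynomial.eval_zero, zero_mul, zero_add, mul_one,
    map_natCast, Polynomial.eval_natCast]
  push_cast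
  linear_combination 2 * g0 + 2 * t * g1 + 2 * t * Complex.I * g2
    + (-2 * t * (2 * c * (t ^ 2 + q) - r * 6 * α * (t ^ 2 + q))) * Complex.I_mul_I
    - 24 * r * t * hq'

theorem baseRestrict_ne_zero (hα : α ≠ 0) {a b c d e f : ℂ} {Q : PlaneCurve 2}
    (hQ : form Q = conicForm a b c d e f) (hne : Q ≠ baseConic hα) :
    baseRestrict α a b c d e f ≠ 0 := by
  intro h
  have hco : ∀ n, (baseRestrict α a b c d e f).coeff n = 0 := fun n => by rw [h]; simp
  have c0 := hco 0
  have c1 := hco 1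
  have c2 := hco 2
  have c3 := hco 3
  have c4 := hco 4
  simp only [baseRestrict, Polynomial.coeff_add, Polynomial.coeff_C_mul, Polynomial.coeff_X_pow,
    Polynomial.coeff_X, Polynomial.coeff_C] at c0 c1 c2 c3 c4
  norm_num [hα] at c0 c1 c2 c3 c4
  obtain ⟨r, hr, hform⟩ := exists_form_conicCurve (h := discr_baseConic hα)
  have hb : b = c := by linear_combination (c0 + c4) / 2
  have hd : d = 0 := by
    have : d * Complex.I = 0 := by linear_combination (c4 - c0) / 2
    simpa using this
  have hf : f = 0 := by linear_combination (c3 - c1) / 2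
  have he : e = 0 := by
    have : e * Complex.I = 0 := by linear_combination (c3 + c1) / 2
    simpa using this
  refine hne (ext_form (c := b / (3 * α) * r⁻¹) ?_)
  rw [baseConic, hform, hQ, smul_smul, mul_assoc, inv_mul_cancel₀ hr, mul_one]
  refine MvPolynomial.funext fun v => ?_
  rw [smul_eval, eval_conicForm, eval_conicForm, hd, he, hf, ← hb]
  rw [← hb] at c2
  field_simp
  field_simp at c2
  linear_combination v 0 ^ 2 * c2 / 4

open Polynomial in
/-- A conic different from the base conic meets it in at most four points, and in at most three if
one of the intersections is not transversal. -/
theorem encard_baseConic_inter_le (hα : α ≠ 0) {Q : PlaneCurve 2} (hne : Q ≠ baseConic hα) :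
    {P | Contains (baseConic hα) P ∧ Contains Q P}.encard ≤ 4 ∧
      ∀ P, Contains (baseConic hα) P → Contains Q P → ¬ TransversalAt (baseConic hα) Q P →
        {P | Contains (baseConic hα) P ∧ Contains Q P}.encard ≤ 3 := by
  classical
  obtain ⟨a, b, c, d, e, f, hQ⟩ := exists_eq_conicForm (isHomogeneous_form Q)
  obtain ⟨r, hr, hform⟩ := exists_form_conicCurve (h := discr_baseConic hα)
  have hp0 := baseRestrict_ne_zero hα hQ hne
  obtain ⟨p, hp⟩ : ∃ p, p = baseRestrict α a b c d e f := ⟨_, rfl⟩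
  rw [← hp] at hp0
  let ψ : ℂ → ProjPlane := fun t => Projectivization.mk ℂ (baseParam α t) (baseParam_ne_zero hα t)
  let P₀ : ProjPlane := Projectivization.mk ℂ baseInfty baseInfty_ne_zero
  let R : Finset ProjPlane := p.roots.toFinset.image ψ
  have hψ : ∀ t, Contains Q (ψ t) ↔ p.IsRoot t := fun t => by
    rw [contains_mk_iff, hQ, ← eval_baseRestrict, hp, IsRoot]
  have hP₀ : Contains Q P₀ ↔ b - c + d * Complex.I = 0 := by
    rw [contains_mk_iff, hQ, eval_conicForm]
    simp only [baseInfty, Matrix.cons_val]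
    constructor
    · intro h
      linear_combination h - c * Complex.I_mul_I
    · intro h
      linear_combination h + c * Complex.I_mul_I
  have hsub : ∀ P, Contains (baseConic hα) P → Contains Q P → P = P₀ ∨ P ∈ R := by
    intro P h1 h2
    rcases exists_baseParam hα h1 with rfl | ⟨t, rfl⟩
    · exact Or.inl rfl
    · refine Or.inr (Finset.mem_image_of_mem ψ ?_)
      rw [Multiset.mem_toFinset, mem_roots hp0]
      exact (hψ t).1 h2
  have hR : R.card ≤ p.natDegree :=
    Finset.card_image_le.trans ((Multiset.toFinset_card_le _).trans (card_roots' p))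
  have hdeg : p.natDegree ≤ 4 := by
    rw [hp, baseRestrict]
    compute_degree
  have hdeg3 : b - c + d * Complex.I = 0 → p.natDegree ≤ 3 := by
    intro h
    rw [hp, baseRestrict, h, Polynomial.C_0, zero_mul, zero_add]
    compute_degree
  have hbound : ∀ n : ℕ, (b - c + d * Complex.I ≠ 0 → R.card ≤ n) →
      (b - c + d * Complex.I = 0 → R.card + 1 ≤ n) →
      {P | Contains (baseConic hα) P ∧ Contains Q P}.encard ≤ n := by
    intro n h1 h2
    by_cases h : b - c + d * Complex.I = 0
    · have : {P | Contains (baseConic hα) P ∧ Contains Q P} ⊆ ((insert P₀ R : Finset ProjPlane) :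
          Set ProjPlane) := fun P hP => by
        simpa using hsub P hP.1 hP.2
      refine (Set.encard_le_encard this).trans ?_
      rw [Set.encard_coe_eq_coe_finsetCard]
      exact_mod_cast (Finset.card_insert_le _ _).trans (h2 h)
    · have : {P | Contains (baseConic hα) P ∧ Contains Q P} ⊆ (R : Set ProjPlane) := fun P hP => by
        rcases hsub P hP.1 hP.2 with rfl | h'
        · exact absurd (hP₀.1 hP.2) h
        · exact h'
      refine (Set.encard_le_encard this).trans ?_
      rw [Set.encard_coe_eq_coe_finsetCard]
      exact_mod_cast h1 h
  refine ⟨hbound 4 (fun _ => hR.trans hdeg) fun h => by have := hdeg3 h; omega, ?_⟩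
  intro P h1 h2 hnt
  -- the gradients at a point without transversality are proportional
  have hprop : ∀ v : Fin 3 → ℂ, v ≠ 0 → eval v (form (baseConic hα)) = 0 → eval v (form Q) = 0 →
      ¬ (eval v (form (baseConic hα)) = 0 ∧ eval v (form Q) = 0 ∧
        LinearIndependent ℂ ![formGradient (form (baseConic hα)) v, formGradient (form Q) v]) →
      ∃ s : ℂ, formGradient (conicForm a b c d e f) v
        = s • formGradient (conicForm 2 (3 * α) (3 * α) 0 0 0) v := by
    intro v hv h1 h2 hnt
    have hsm := (isSmooth_iff (baseConic hα)).1 isSmooth_conicCurve v hv h1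
    have hli : ¬ LinearIndependent ℂ
        ![formGradient (form (baseConic hα)) v, formGradient (form Q) v] :=
      fun h => hnt ⟨h1, h2, h⟩
    rw [LinearIndependent.pair_iff' hsm] at hli
    push Not at hli
    obtain ⟨s, hs⟩ := hli
    refine ⟨s * r, ?_⟩
    rw [← hQ, ← hs, baseConic, hform, formGradient_smul, smul_smul]
  rcases exists_baseParam hα h1 with rfl | ⟨t, rfl⟩
  · rw [transversalAt_mk_iff] at hnt
    rw [contains_mk_iff] at h1 h2
    obtain ⟨s, hs⟩ := hprop _ baseInfty_ne_zero h1 h2 hnt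
    rw [formGradient_conicForm, formGradient_conicForm] at hs
    have g0 := congrFun hs 0
    have g1 := congrFun hs 1
    have g2 := congrFun hs 2
    simp only [baseInfty, Pi.smul_apply, smul_eq_mul, Matrix.cons_val] at g0 g1 g2
    have hlead : b - c + d * Complex.I = 0 := hP₀.1 ((contains_mk_iff Q baseInfty_ne_zero).2 h2)
    have hdeg2 : p.natDegree ≤ 2 := by
      have : f + e * Complex.I = 0 := by linear_combination g0
      rw [hp, baseRestrict, hlead, this, mul_zero, Polynomial.C_0, zero_mul, zero_mul,
        zero_add, zero_add]
      compute_degree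
    exact hbound 3 (fun h => absurd hlead h) fun _ => by omega
  · have hroot : p.IsRoot t := (hψ t).1 h2
    rw [transversalAt_mk_iff] at hnt
    rw [contains_mk_iff] at h1 h2
    obtain ⟨s, hs⟩ := hprop _ (baseParam_ne_zero hα t) h1 h2 hnt
    have hder : p.derivative.IsRoot t := hp ▸ isRoot_derivative_baseRestrict hα hs
    have hmult : 1 < p.rootMultiplicity t :=
      (one_lt_rootMultiplicity_iff_isRoot hp0).2 ⟨hroot, hder⟩
    have hlt : p.roots.toFinset.card < p.natDegree := by
      refine lt_of_lt_of_le (lt_of_le_of_ne (Multiset.toFinset_card_le _) ?_)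
        (card_roots' p)
      intro heq
      have hnd := Multiset.toFinset_card_eq_card_iff_nodup.1 heq
      have := Multiset.nodup_iff_count_le_one.1 hnd t
      rw [count_roots] at this
      omega
    have hR' : R.card < p.natDegree := lt_of_le_of_lt Finset.card_image_le hlt
    exact hbound 3 (fun _ => by omega) fun h => by have := hdeg3 h; omega

end Bezout

/-! ### Counting incidences -/

/-- The conic `Q` passes through 32 triple points and 16 double points of the arrangement `A` and
through no point of higher multiplicity, and it meets all other members transversally. -/
structure IsBalanced (A : Set (PlaneCurve 2)) (Q : PlaneCurve 2) : Prop where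
  mult_le : ∀ P, Contains Q P → arrangementMult A P ≤ 3
  triple : {P | Contains Q P ∧ arrangementMult A P = 3}.encard = 32
  double : {P | Contains Q P ∧ arrangementMult A P = 2}.encard = 16
  transversal : ∀ Q' ∈ A, Q' ≠ Q → ∀ P, Contains Q P → Contains Q' P → TransversalAt Q Q' P

theorem IsBalanced.pull {A : Set (PlaneCurve 2)} {Q : PlaneCurve 2} (h : IsBalanced A Q)
    (g : CoordChange) : IsBalanced (pull g '' A) (pull g Q) where
  mult_le P hP := by
    rw [arrangementMult_image_pull]
    exact h.mult_le _ ((contains_pull g Q P).1 hP)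
  triple := by
    rw [← h.triple]
    simp only [arrangementMult_image_pull, contains_pull]
    exact Set.encard_preimage_of_bijective (MulAction.bijective g)
      {P | Contains Q P ∧ arrangementMult A P = 3}
  double := by
    rw [← h.double]
    simp only [arrangementMult_image_pull, contains_pull]
    exact Set.encard_preimage_of_bijective (MulAction.bijective g)
      {P | Contains Q P ∧ arrangementMult A P = 2}
  transversal := by
    rintro _ ⟨Q', hQ', rfl⟩ hne P hP hP'
    rw [transversalAt_pull]
    rw [contains_pull] at hP hP'
    exact h.transversal Q' hQ' (fun h => hne (by rw [h])) _ hP hP'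

/-- If a conic of an arrangement of 21 conics meets each of the others in at most four points, then
there are at most 80 incidences on it. When 32 points of multiplicity at least three and 16 further
points of multiplicity at least two are known, these account for all 80, so that there is no
other intersection, and all intersections are transversal. -/
theorem isBalanced_of_points {A : Set (PlaneCurve 2)} (hA : A.encard = 21) {Q : PlaneCurve 2}
    (hQ : Q ∈ A)
    (hle : ∀ Q' ∈ A, Q' ≠ Q → {P | Contains Q P ∧ Contains Q' P}.encard ≤ 4)
    (htr : ∀ Q' ∈ A, Q' ≠ Q → ∀ P, Contains Q P → Contains Q' P → ¬ TransversalAt Q Q' P →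
      {P | Contains Q P ∧ Contains Q' P}.encard ≤ 3)
    {T D : Finset ProjPlane} (hTD : Disjoint T D) (hT : T.card = 32) (hD : D.card = 16)
    (hT' : ∀ P ∈ T, Contains Q P ∧ 3 ≤ arrangementMult A P)
    (hD' : ∀ P ∈ D, Contains Q P ∧ 2 ≤ arrangementMult A P) : IsBalanced A Q := by
  classical
  have hfin : A.Finite := Set.finite_of_encard_eq_coe (k := 21) hA
  obtain ⟨B, hB⟩ : ∃ B : Finset (PlaneCurve 2), (B : Set (PlaneCurve 2)) = A \ {Q} :=
    (hfin.subset Set.sdiff_subset).exists_finset_coe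
  have hmemB : ∀ Q', Q' ∈ B ↔ Q' ∈ A ∧ Q' ≠ Q := fun Q' => by
    rw [← Finset.mem_coe, hB]
    simp
  have hBcard : B.card = 20 := by
    have h := Set.encard_sdiff_singleton_add_one hQ
    rw [hA, ← hB, Set.encard_coe_eq_coe_finsetCard] at h
    have : B.card + 1 = 21 := by exact_mod_cast h
    omega
  have hSfin : ∀ Q' ∈ B, {P | Contains Q P ∧ Contains Q' P}.Finite := fun Q' h =>
    Set.finite_of_encard_le_coe (k := 4) (hle Q' ((hmemB Q').1 h).1 ((hmemB Q').1 h).2)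
  obtain ⟨S, hS⟩ : ∃ S : Finset ProjPlane, ∀ P, P ∈ S ↔ Contains Q P ∧ ∃ Q' ∈ B, Contains Q' P := by
    have : (⋃ Q' ∈ B, {P | Contains Q P ∧ Contains Q' P}).Finite :=
      B.finite_toSet.biUnion hSfin
    refine ⟨this.toFinset, fun P => ?_⟩
    simp only [Set.Finite.mem_toFinset, Set.mem_iUnion, Set.mem_ofPred_eq, exists_prop]
    tauto
  -- the number of other members through a point
  let m : ProjPlane → ℕ := fun P => (B.filter fun Q' => Contains Q' P).card
  have hm : ∀ P, Contains Q P → arrangementMult A P = m P + 1 := by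
    intro P hP
    have : curvesThrough A P =
        insert Q ((B.filter fun Q' => Contains Q' P : Finset _) : Set _) := by
      ext Q'
      simp only [curvesThrough, Set.mem_ofPred_eq, Set.mem_insert_iff, Finset.coe_filter, hmemB]
      constructor
      · intro h
        by_cases hQ' : Q' = Q
        · exact Or.inl hQ'
        · exact Or.inr ⟨⟨h.1, hQ'⟩, h.2⟩
      · rintro (rfl | h)
        · exact ⟨hQ, hP⟩
        · exact ⟨h.1.1, h.2⟩
    rw [arrangementMult, this, Set.encard_insert_of_notMem, Set.encard_coe_eq_coe_finsetCard]
    simp [hmemB]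
  have hS' : ∀ P, P ∈ S ↔ Contains Q P ∧ 1 ≤ m P := fun P => by
    rw [hS, Nat.one_le_iff_ne_zero, Finset.card_ne_zero]
    simp [Finset.Nonempty]
  have hTm : ∀ P ∈ T, Contains Q P ∧ 2 ≤ m P := fun P hP => by
    obtain ⟨h1, h2⟩ := hT' P hP
    rw [hm P h1] at h2
    have : 3 ≤ m P + 1 := by exact_mod_cast h2
    exact ⟨h1, by omega⟩
  have hDm : ∀ P ∈ D, Contains Q P ∧ 1 ≤ m P := fun P hP => by
    obtain ⟨h1, h2⟩ := hD' P hP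
    rw [hm P h1] at h2
    have : 2 ≤ m P + 1 := by exact_mod_cast h2
    exact ⟨h1, by omega⟩
  let c : PlaneCurve 2 → ℕ := fun Q' => (S.filter fun P => Contains Q' P).card
  have hcS : ∀ Q' ∈ B, ((S.filter fun P => Contains Q' P : Finset _) : Set ProjPlane) =
      {P | Contains Q P ∧ Contains Q' P} := fun Q' h => by
    ext P
    simp only [Finset.coe_filter, hS, Set.mem_ofPred_eq]
    constructor
    · exact fun h => ⟨h.1.1, h.2⟩
    · exact fun h' => ⟨⟨h'.1, Q', h, h'.2⟩, h'.2⟩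
  have hc : ∀ Q' ∈ B, c Q' ≤ 4 := fun Q' h => by
    have := hle Q' ((hmemB Q').1 h).1 ((hmemB Q').1 h).2
    rw [← hcS Q' h, Set.encard_coe_eq_coe_finsetCard] at this
    exact_mod_cast this
  have hsum : ∑ P ∈ S, m P = ∑ Q' ∈ B, c Q' :=
    (Finset.sum_card_bipartiteAbove_eq_sum_card_bipartiteBelow fun P Q' => Contains Q' P)
  have hle80 : ∑ Q' ∈ B, c Q' ≤ ∑ _Q' ∈ B, 4 := Finset.sum_le_sum hc
  let wt : ProjPlane → ℕ := fun P => if P ∈ T then 2 else if P ∈ D then 1 else 0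
  have hwt : ∀ P ∈ S, wt P ≤ m P := fun P _ => by
    simp only [wt]
    split_ifs with h1 h2
    · exact (hTm P h1).2
    · exact (hDm P h2).2
    · exact Nat.zero_le _
  have hTS : T ⊆ S := fun P hP => (hS' P).2 ⟨(hTm P hP).1, by have := (hTm P hP).2; omega⟩
  have hDS : D ⊆ S := fun P hP => (hS' P).2 (hDm P hP)
  have hwtsum : 80 ≤ ∑ P ∈ S, wt P := by
    have h1 : ∑ P ∈ T ∪ D, wt P ≤ ∑ P ∈ S, wt P :=
      Finset.sum_le_sum_of_subset (Finset.union_subset hTS hDS)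
    rw [Finset.sum_union hTD] at h1
    have h2 : ∑ P ∈ T, wt P = ∑ _P ∈ T, 2 :=
      Finset.sum_congr rfl fun P hP => by simp only [wt, if_pos hP]
    have h3 : ∑ P ∈ D, wt P = ∑ _P ∈ D, 1 := Finset.sum_congr rfl fun P hP => by
      simp only [wt, if_pos hP, if_neg (Finset.disjoint_right.1 hTD hP)]
    rw [h2, h3] at h1
    simp only [Finset.sum_const, hT, hD, smul_eq_mul] at h1
    omega
  have hle80' : ∑ _Q' ∈ B, 4 = 80 := by simp [hBcard]
  have hmwt : ∀ P ∈ S, wt P = m P :=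
    (Finset.sum_eq_sum_iff_of_le hwt).1 (le_antisymm (Finset.sum_le_sum hwt) (by omega))
  have hc4 : ∀ Q' ∈ B, c Q' = 4 :=
    (Finset.sum_eq_sum_iff_of_le hc).1 (by have := Finset.sum_le_sum hwt; omega)
  have hmP : ∀ P, Contains Q P → m P = wt P := fun P hP => by
    by_cases h : P ∈ S
    · exact (hmwt P h).symm
    · have h1 : ¬ 1 ≤ m P := fun h1 => h ((hS' P).2 ⟨hP, h1⟩)
      have h2 : wt P = 0 := by
        simp only [wt]
        rw [if_neg fun h' => h (hTS h'), if_neg fun h' => h (hDS h')]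
      omega
  refine ⟨fun P hP => ?_, ?_, ?_, ?_⟩
  · rw [hm P hP, hmP P hP]
    simp only [wt]
    split_ifs <;> norm_num
  · have : {P | Contains Q P ∧ arrangementMult A P = 3} = T := by
      ext P
      constructor
      · rintro ⟨hP, h⟩
        rw [hm P hP, hmP P hP] at h
        have : wt P + 1 = 3 := by exact_mod_cast h
        by_contra hPT
        simp only [wt, if_neg (show P ∉ T from hPT)] at this
        split_ifs at this <;> omega
      · intro hP
        have h1 := (hTm P hP).1
        refine ⟨h1, ?_⟩
        rw [hm P h1, hmP P h1]
        simp only [wt, if_pos (show P ∈ T from hP)]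
        norm_num
    rw [this, Set.encard_coe_eq_coe_finsetCard, hT]
    rfl
  · have : {P | Contains Q P ∧ arrangementMult A P = 2} = D := by
      ext P
      constructor
      · rintro ⟨hP, h⟩
        rw [hm P hP, hmP P hP] at h
        have : wt P + 1 = 2 := by exact_mod_cast h
        by_contra hPD
        simp only [wt, if_neg (show P ∉ D from hPD)] at this
        split_ifs at this <;> omega
      · intro hP
        have h1 := (hDm P hP).1
        refine ⟨h1, ?_⟩
        rw [hm P h1, hmP P h1]
        simp only [wt, if_pos (show P ∈ D from hP), if_neg (Finset.disjoint_right.1 hTD hP)]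
        norm_num
    rw [this, Set.encard_coe_eq_coe_finsetCard, hD]
    rfl
  · intro Q' hQ' hne P hP hP'
    by_contra hnt
    have hB' := (hmemB Q').2 ⟨hQ', hne⟩
    have h3 := htr Q' hQ' hne P hP hP' hnt
    rw [← hcS Q' hB', Set.encard_coe_eq_coe_finsetCard] at h3
    have : c Q' ≤ 3 := by exact_mod_cast h3
    have := hc4 Q' hB'
    omega

/-- Double counting of the incidences between the conics and the points of multiplicity `n`. -/
theorem encard_mult_mul {A : Set (PlaneCurve 2)} {N k n : ℕ} (hA : A.encard = N) (hn : n ≠ 0)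
    (h : ∀ Q ∈ A, {P | Contains Q P ∧ arrangementMult A P = n}.encard = k) :
    ∃ x : ℕ, {P : ProjPlane | arrangementMult A P = n}.encard = x ∧ x * n = N * k := by
  classical
  have hfin : A.Finite := Set.finite_of_encard_eq_coe hA
  obtain ⟨B, rfl⟩ := hfin.exists_finset_coe
  have hXfin : {P : ProjPlane | arrangementMult (B : Set (PlaneCurve 2)) P = n}.Finite := by
    refine (B.finite_toSet.biUnion fun Q hQ => Set.finite_of_encard_eq_coe (h Q hQ)).subset ?_
    intro P hP
    have hne : (curvesThrough (B : Set (PlaneCurve 2)) P).Nonempty := by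
      rw [← Set.encard_ne_zero]
      change arrangementMult _ P ≠ 0
      rw [show arrangementMult _ P = n from hP]
      exact_mod_cast hn
    obtain ⟨Q, hQ, hQP⟩ := hne
    exact Set.mem_biUnion hQ ⟨hQP, hP⟩
  obtain ⟨X, hX⟩ := hXfin.exists_finset_coe
  have hmemX : ∀ P, P ∈ X ↔ arrangementMult (B : Set (PlaneCurve 2)) P = n := fun P => by
    rw [← Finset.mem_coe, hX]
    rfl
  refine ⟨X.card, by rw [← hX, Set.encard_coe_eq_coe_finsetCard], ?_⟩
  rw [Set.encard_coe_eq_coe_finsetCard] at hA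
  have hN : B.card = N := by exact_mod_cast hA
  have h1 : ∀ P ∈ X, (B.filter fun Q => Contains Q P).card = n := fun P hP => by
    have h2 := (hmemX P).1 hP
    have : curvesThrough (B : Set (PlaneCurve 2)) P =
        ((B.filter fun Q => Contains Q P : Finset _) : Set _) := by
      ext Q
      simp [curvesThrough]
    rw [arrangementMult, this, Set.encard_coe_eq_coe_finsetCard] at h2
    exact_mod_cast h2
  have h2 : ∀ Q ∈ B, (X.filter fun P => Contains Q P).card = k := fun Q hQ => by
    have h3 := h Q hQ
    have : {P | Contains Q P ∧ arrangementMult (B : Set (PlaneCurve 2)) P = n} =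
        ((X.filter fun P => Contains Q P : Finset _) : Set _) := by
      ext P
      simp [hmemX, and_comm]
    rw [this, Set.encard_coe_eq_coe_finsetCard] at h3
    exact_mod_cast h3
  have hsum : ∑ P ∈ X, (B.filter fun Q => Contains Q P).card =
      ∑ Q ∈ B, (X.filter fun P => Contains Q P).card :=
    Finset.sum_card_bipartiteAbove_eq_sum_card_bipartiteBelow fun P Q => Contains Q P
  rw [Finset.sum_congr rfl h1, Finset.sum_congr rfl h2] at hsum
  simpa [hN] using hsum

/-! ### The quartic with octahedral symmetry -/

/-- The quartic `x⁴ + y⁴ + z⁴ + 3α(x²y² + y²z² + z²x²)`, which is projectively equivalent to the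
Klein quartic if `α² + α + 2 = 0`. -/
def octahedralQuartic (α : ℂ) : MvPolynomial (Fin 3) ℂ :=
  X 0 ^ 4 + X 1 ^ 4 + X 2 ^ 4
    + C (3 * α) * (X 0 ^ 2 * X 1 ^ 2 + X 1 ^ 2 * X 2 ^ 2 + X 2 ^ 2 * X 0 ^ 2)

theorem eval_octahedralQuartic (α : ℂ) (v : Fin 3 → ℂ) :
    eval v (octahedralQuartic α) = v 0 ^ 4 + v 1 ^ 4 + v 2 ^ 4
      + 3 * α * (v 0 ^ 2 * v 1 ^ 2 + v 1 ^ 2 * v 2 ^ 2 + v 2 ^ 2 * v 0 ^ 2) := by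
  simp [octahedralQuartic]

theorem eval_polarForm_octahedralQuartic (α : ℂ) (p v : Fin 3 → ℂ) :
    eval v (polarForm (octahedralQuartic α) p) =
      p 0 * (4 * v 0 ^ 3 + 6 * α * v 0 * (v 1 ^ 2 + v 2 ^ 2))
      + p 1 * (4 * v 1 ^ 3 + 6 * α * v 1 * (v 2 ^ 2 + v 0 ^ 2))
      + p 2 * (4 * v 2 ^ 3 + 6 * α * v 2 * (v 0 ^ 2 + v 1 ^ 2)) := by
  rw [eval_polarForm, Fin.sum_univ_three]
  simp [formGradient, octahedralQuartic, pderiv_X, Derivation.leibniz, Derivation.leibniz_pow]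
  ring

section Octahedral

variable {α : ℂ}

/-- A conic is a member of the arrangement if a line completes it to a polar. -/
theorem conicCurve_mem_conicsOf {a b c d e f : ℂ}
    {h : 4 * a * b * c + d * e * f - a * d ^ 2 - b * e ^ 2 - c * f ^ 2 ≠ 0}
    {F : MvPolynomial (Fin 3) ℂ} {p : Fin 3 → ℂ} (hp : p ≠ 0) (u₀ u₁ u₂ : ℂ)
    (hpol : ∀ v, eval v (polarForm F p) =
      (u₀ * v 0 + u₁ * v 1 + u₂ * v 2) * eval v (conicForm a b c d e f)) :
    conicCurve a b c d e f h ∈ conicsOf F := by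
  refine ⟨isSmooth_conicCurve, p, hp, ?_⟩
  obtain ⟨r, hr, hform⟩ := exists_form_conicCurve (h := h)
  rw [hform, smul_dvd_iff hr]
  refine Dvd.intro_left (C u₀ * X 0 + C u₁ * X 1 + C u₂ * X 2) (MvPolynomial.funext fun v => ?_)
  rw [hpol]
  simp

theorem ne_zero_of_octahedral (hα : α ^ 2 + α + 2 = 0) : α ≠ 0 := by
  rintro rfl
  norm_num at hα

theorem baseConic_mem (hα : α ≠ 0) : baseConic hα ∈ conicsOf (octahedralQuartic α) := by
  refine conicCurve_mem_conicsOf (p := ![1, 0, 0]) (fun h => by simpa using congrFun h 0) 2 0 0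
    fun v => ?_
  rw [eval_polarForm_octahedralQuartic, eval_conicForm]
  simp only [Matrix.cons_val]
  ring

/-- Among the polars of the octahedral quartic only the one of the first coordinate point contains
the base conic. -/
theorem eq_smul_of_baseConic_dvd (hα : α ≠ 0) (hα' : 4 - 6 * α ≠ 0) {p : Fin 3 → ℂ}
    (h : form (baseConic hα) ∣ polarForm (octahedralQuartic α) p) : p = p 0 • ![1, 0, 0] := by
  obtain ⟨r, hr, hform⟩ := exists_form_conicCurve (h := discr_baseConic hα)
  rw [baseConic, hform, smul_dvd_iff hr] at h
  obtain ⟨L, hL⟩ := h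
  have key : ∀ v, eval v (conicForm 2 (3 * α) (3 * α) 0 0 0) = 0 →
      eval v (polarForm (octahedralQuartic α) p) = 0 := fun v hv => by
    rw [hL, map_mul, hv, zero_mul]
  have hI := Complex.I_mul_I
  have k1 := key ![0, 1, Complex.I] (by
    rw [eval_conicForm]
    simp only [Matrix.cons_val]
    linear_combination 3 * α * hI)
  have k2 := key ![0, 1, -Complex.I] (by
    rw [eval_conicForm]
    simp only [Matrix.cons_val]
    linear_combination 3 * α * hI)
  rw [eval_polarForm_octahedralQuartic] at k1 k2
  simp only [Matrix.cons_val] at k1 k2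
  have h1 : p 1 = 0 := by
    have : (4 - 6 * α) * p 1 = 0 := by linear_combination (k1 + k2) / 2 - 6 * α * p 1 * hI
    exact (mul_eq_zero.1 this).resolve_left hα'
  have h2 : p 2 = 0 := by
    have : (4 - 6 * α) * (p 2 * Complex.I) = 0 := by
      linear_combination -(k1 - k2) / 2 + 4 * p 2 * Complex.I * hI
    simpa using (mul_eq_zero.1 this).resolve_left hα'
  ext i
  fin_cases i <;> simp [h1, h2]

theorem three_le_arrangementMult {A : Set (PlaneCurve 2)} {P : ProjPlane} {Q₁ Q₂ Q₃ : PlaneCurve 2}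
    (h₁ : Q₁ ∈ A) (h₂ : Q₂ ∈ A) (h₃ : Q₃ ∈ A) (h₁₂ : Q₁ ≠ Q₂) (h₁₃ : Q₁ ≠ Q₃) (h₂₃ : Q₂ ≠ Q₃)
    (hP₁ : Contains Q₁ P) (hP₂ : Contains Q₂ P) (hP₃ : Contains Q₃ P) :
    3 ≤ arrangementMult A P := by
  have : ({Q₁, Q₂, Q₃} : Set (PlaneCurve 2)).encard = 3 :=
    Set.encard_eq_three.2 ⟨_, _, _, h₁₂, h₁₃, h₂₃, rfl⟩
  rw [← this]
  refine Set.encard_le_encard ?_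
  rintro Q (rfl | rfl | rfl)
  exacts [⟨h₁, hP₁⟩, ⟨h₂, hP₂⟩, ⟨h₃, hP₃⟩]

theorem two_le_arrangementMult {A : Set (PlaneCurve 2)} {P : ProjPlane} {Q₁ Q₂ : PlaneCurve 2}
    (h₁ : Q₁ ∈ A) (h₂ : Q₂ ∈ A) (h₁₂ : Q₁ ≠ Q₂) (hP₁ : Contains Q₁ P) (hP₂ : Contains Q₂ P) :
    2 ≤ arrangementMult A P := by
  rw [← Set.encard_pair h₁₂]
  refine Set.encard_le_encard ?_
  rintro Q (rfl | rfl)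
  exacts [⟨h₁, hP₁⟩, ⟨h₂, hP₂⟩]

/-- The point `(1 : y : z)`. -/
def affinePoint (q : ℂ × ℂ) : ProjPlane :=
  Projectivization.mk ℂ ![1, q.1, q.2] fun h => by simpa using congrFun h 0

theorem affinePoint_injective : Function.Injective affinePoint := by
  rintro ⟨y, z⟩ ⟨y', z'⟩ h
  rw [affinePoint, affinePoint, Projectivization.mk_eq_mk_iff'] at h
  obtain ⟨a, ha⟩ := h
  have h0 := congrFun ha 0
  have h1 := congrFun ha 1
  have h2 := congrFun ha 2
  simp at h0 h1 h2
  rw [h0] at h1 h2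
  simp [← h1, ← h2]

theorem contains_conicCurve_affinePoint {a b c d e f : ℂ}
    {h : 4 * a * b * c + d * e * f - a * d ^ 2 - b * e ^ 2 - c * f ^ 2 ≠ 0} {q : ℂ × ℂ} :
    Contains (conicCurve a b c d e f h) (affinePoint q) ↔
      a + b * q.1 ^ 2 + c * q.2 ^ 2 + d * (q.1 * q.2) + e * q.2 + f * q.1 = 0 := by
  rw [affinePoint, contains_conicCurve]
  simp

theorem contains_baseConic_affinePoint (hα : α ^ 2 + α + 2 = 0) {q : ℂ × ℂ} :
    Contains (baseConic (ne_zero_of_octahedral hα)) (affinePoint q) ↔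
      q.1 ^ 2 + q.2 ^ 2 = (1 + α) / 3 := by
  have h0 := ne_zero_of_octahedral hα
  rw [baseConic, contains_conicCurve_affinePoint]
  constructor
  · intro h
    refine mul_left_cancel₀ (mul_ne_zero three_ne_zero h0) ?_
    linear_combination h - hα
  · intro h
    linear_combination 3 * α * h + hα

/-- The linear map `(x, y, z) ↦ (x, -y, z)`. -/
def reflectChange : CoordChange :=
  CoordChange.ofMatrix !![1, 0, 0; 0, -1, 0; 0, 0, 1] fun v hv => by
    ext i
    have := congrFun hv i
    fin_cases i <;> simpa [Matrix.mulVec, dotProduct, Fin.sum_univ_three] using this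

/-- The linear map `(x, y, z) ↦ (x, z, y)`. -/
def swapChange : CoordChange :=
  CoordChange.ofMatrix !![1, 0, 0; 0, 0, 1; 0, 1, 0] fun v hv => by
    ext i
    have h0 := congrFun hv 0
    have h1 := congrFun hv 1
    have h2 := congrFun hv 2
    fin_cases i
    · simpa [Matrix.mulVec, dotProduct, Fin.sum_univ_three] using h0
    · simpa [Matrix.mulVec, dotProduct, Fin.sum_univ_three] using h2
    · simpa [Matrix.mulVec, dotProduct, Fin.sum_univ_three] using h1

theorem reflectChange_apply (v : Fin 3 → ℂ) : reflectChange v = ![v 0, -v 1, v 2] := by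
  rw [reflectChange, CoordChange.ofMatrix_apply]
  ext i
  fin_cases i <;> simp [Matrix.mulVec, dotProduct, Fin.sum_univ_three]

theorem swapChange_apply (v : Fin 3 → ℂ) : swapChange v = ![v 0, v 2, v 1] := by
  rw [swapChange, CoordChange.ofMatrix_apply]
  ext i
  fin_cases i <;> simp [Matrix.mulVec, dotProduct, Fin.sum_univ_three]

theorem arrangementMult_smul_of_invariant {F : MvPolynomial (Fin 3) ℂ} {g : CoordChange}
    (hg : substForm g F = F) (P : ProjPlane) :
    arrangementMult (conicsOf F) (g • P) = arrangementMult (conicsOf F) P := by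
  rw [← arrangementMult_image_pull, image_pull_conicsOf, hg]

theorem arrangementMult_neg_fst (α y z : ℂ) :
    arrangementMult (conicsOf (octahedralQuartic α)) (affinePoint (-y, z)) =
      arrangementMult (conicsOf (octahedralQuartic α)) (affinePoint (y, z)) := by
  have hg : substForm reflectChange (octahedralQuartic α) = octahedralQuartic α :=
    MvPolynomial.funext fun v => by
      rw [eval_substForm, eval_octahedralQuartic, eval_octahedralQuartic, reflectChange_apply]
      simp only [Matrix.cons_val]
      ring
  rw [← arrangementMult_smul_of_invariant hg (affinePoint (y, z))]
  congr 1
  simp only [affinePoint, Projectivization.smul_mk]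
  congr 1
  exact (reflectChange_apply ![1, y, z]).symm

theorem arrangementMult_swap (α y z : ℂ) :
    arrangementMult (conicsOf (octahedralQuartic α)) (affinePoint (z, y)) =
      arrangementMult (conicsOf (octahedralQuartic α)) (affinePoint (y, z)) := by
  have hg : substForm swapChange (octahedralQuartic α) = octahedralQuartic α :=
    MvPolynomial.funext fun v => by
      rw [eval_substForm, eval_octahedralQuartic, eval_octahedralQuartic, swapChange_apply]
      simp only [Matrix.cons_val]
      ring
  rw [← arrangementMult_smul_of_invariant hg (affinePoint (y, z))]
  congr 1
  simp only [affinePoint, Projectivization.smul_mk]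
  congr 1
  exact (swapChange_apply ![1, y, z]).symm

/-- The orbit of an affine point under the symmetries of the square `(±y, ±z)`, `(±z, ±y)`. -/
def squareOrbit (q : ℂ × ℂ) : Finset (ℂ × ℂ) :=
  {(q.1, q.2), (-q.1, q.2), (q.1, -q.2), (-q.1, -q.2),
    (q.2, q.1), (-q.2, q.1), (q.2, -q.1), (-q.2, -q.1)}

theorem arrangementMult_squareOrbit (α : ℂ) {q r : ℂ × ℂ} (h : r ∈ squareOrbit q) :
    arrangementMult (conicsOf (octahedralQuartic α)) (affinePoint r) =
      arrangementMult (conicsOf (octahedralQuartic α)) (affinePoint q) := by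
  obtain ⟨y, z⟩ := q
  have hsnd : ∀ y z, arrangementMult (conicsOf (octahedralQuartic α)) (affinePoint (y, -z)) =
      arrangementMult (conicsOf (octahedralQuartic α)) (affinePoint (y, z)) := fun y z => by
    rw [arrangementMult_swap, arrangementMult_neg_fst, arrangementMult_swap]
  simp only [squareOrbit, Finset.mem_insert, Finset.mem_singleton] at h
  rcases h with rfl | rfl | rfl | rfl | rfl | rfl | rfl | rfl <;>
    simp only [arrangementMult_neg_fst, hsnd, arrangementMult_swap α y z]

theorem sq_add_sq_squareOrbit {q r : ℂ × ℂ} (h : r ∈ squareOrbit q) :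
    r.1 ^ 2 + r.2 ^ 2 = q.1 ^ 2 + q.2 ^ 2 := by
  simp only [squareOrbit, Finset.mem_insert, Finset.mem_singleton] at h
  rcases h with rfl | rfl | rfl | rfl | rfl | rfl | rfl | rfl <;> simp [add_comm]

theorem sq_mul_squareOrbit {q r : ℂ × ℂ} (h : r ∈ squareOrbit q) :
    (r.1 * r.2) ^ 2 = (q.1 * q.2) ^ 2 := by
  simp only [squareOrbit, Finset.mem_insert, Finset.mem_singleton] at h
  rcases h with rfl | rfl | rfl | rfl | rfl | rfl | rfl | rfl <;> ring

theorem card_squareOrbit {q : ℂ × ℂ} (h1 : q.1 ≠ 0) (h2 : q.2 ≠ 0) (h3 : q.1 ^ 2 ≠ q.2 ^ 2) :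
    (squareOrbit q).card = 8 := by
  obtain ⟨y, z⟩ := q
  simp only at h1 h2 h3
  have hy : y ≠ -y := fun h => h1 (by linear_combination h / 2)
  have hz : z ≠ -z := fun h => h2 (by linear_combination h / 2)
  have hyz : y ≠ z := fun h => h3 (by rw [h])
  have hyz' : y ≠ -z := fun h => h3 (by rw [h]; ring)
  have hyz'' : -y ≠ z := fun h => h3 (by rw [← h]; ring)
  simp [squareOrbit, Finset.card_insert_of_notMem, hy, hz, hyz, hyz', hyz'', hy.symm, hz.symm]

theorem card_squareOrbit_zero {z : ℂ} (h : z ≠ 0) : (squareOrbit (0, z)).card = 4 := by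
  have hz : z ≠ -z := fun h' => h (by linear_combination h' / 2)
  have : squareOrbit (0, z) = {(0, z), (0, -z), (z, 0), (-z, 0)} := by
    ext r
    simp [squareOrbit]
  rw [this]
  simp [Finset.card_insert_of_notMem, hz, h, h.symm]

theorem card_squareOrbit_neg {y : ℂ} (h : y ≠ 0) : (squareOrbit (y, -y)).card = 4 := by
  have hy : y ≠ -y := fun h' => h (by linear_combination h' / 2)
  have : squareOrbit (y, -y) = {(y, y), (y, -y), (-y, y), (-y, -y)} := by
    ext r
    simp [squareOrbit]
    tauto
  rw [this]
  simp [Finset.card_insert_of_notMem, hy, hy.symm]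

end Octahedral

/-! ### The 48 points on the base conic -/

section Octahedral

variable {α : ℂ}

theorem discr_axisConic (hα : α ^ 2 + α + 2 = 0) :
    4 * (3 * α) * 2 * (3 * α) + 0 * 0 * 0 - 3 * α * 0 ^ 2 - 2 * 0 ^ 2 - 3 * α * 0 ^ 2 ≠ 0 := by
  grind

theorem discr_diagonalConic (hα : α ^ 2 + α + 2 = 0) {s : ℂ} (hs : s ^ 2 = 1) :
    4 * 2 * 2 * (3 * α) + 0 * 0 * (s * (3 * α - 2)) - 2 * 0 ^ 2 - 2 * 0 ^ 2
      - 3 * α * (s * (3 * α - 2)) ^ 2 ≠ 0 := by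
  grind

theorem discr_oppositeConic (hα : α ^ 2 + α + 2 = 0) :
    4 * (3 * α) * 2 * 2 + (3 * α - 2) * 0 * 0 - 3 * α * (3 * α - 2) ^ 2 - 2 * 0 ^ 2 - 2 * 0 ^ 2
      ≠ 0 := by
  grind

theorem discr_firstConic (hα : α ^ 2 + α + 2 = 0) {s : ℂ} (hs : s ^ 2 = 1) :
    4 * 2 * (α - 1) * (α - 1) + -(2 * (1 + 2 * α)) * (s * (3 - α)) * (s * (3 - α))
      - 2 * (-(2 * (1 + 2 * α))) ^ 2 - (α - 1) * (s * (3 - α)) ^ 2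
      - (α - 1) * (s * (3 - α)) ^ 2 ≠ 0 := by
  grind

theorem discr_secondConic (hα : α ^ 2 + α + 2 = 0) {s : ℂ} (hs : s ^ 2 = 1) :
    4 * 2 * -(2 + α) * 2 + -(4 + α) * (s * (3 * α - 2)) * -(s * (4 + α))
      - 2 * (-(4 + α)) ^ 2 - -(2 + α) * (s * (3 * α - 2)) ^ 2
      - 2 * (-(s * (4 + α))) ^ 2 ≠ 0 := by
  grind

/-- The conic in the polar of `(0 : 1 : 0)`. -/
def axisConic (hα : α ^ 2 + α + 2 = 0) : PlaneCurve 2 :=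
  conicCurve (3 * α) 2 (3 * α) 0 0 0 (discr_axisConic hα)

/-- The conic in the polar of `(1 : s : 0)`, where `s = ±1`. -/
def diagonalConic (hα : α ^ 2 + α + 2 = 0) {s : ℂ} (hs : s ^ 2 = 1) : PlaneCurve 2 :=
  conicCurve 2 2 (3 * α) 0 0 (s * (3 * α - 2)) (discr_diagonalConic hα hs)

/-- The conic in the polar of `(0 : 1 : 1)`. -/
def oppositeConic (hα : α ^ 2 + α + 2 = 0) : PlaneCurve 2 :=
  conicCurve (3 * α) 2 2 (3 * α - 2) 0 0 (discr_oppositeConic hα)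

/-- The conic in the polar of `(α : s : s)`, where `s = ±1`. -/
def firstConic (hα : α ^ 2 + α + 2 = 0) {s : ℂ} (hs : s ^ 2 = 1) : PlaneCurve 2 :=
  conicCurve 2 (α - 1) (α - 1) (-(2 * (1 + 2 * α))) (s * (3 - α)) (s * (3 - α))
    (discr_firstConic hα hs)

/-- The conic in the polar of `(s : α : 1)`, where `s = ±1`. -/
def secondConic (hα : α ^ 2 + α + 2 = 0) {s : ℂ} (hs : s ^ 2 = 1) : PlaneCurve 2 :=
  conicCurve 2 (-(2 + α)) 2 (-(4 + α)) (s * (3 * α - 2)) (-(s * (4 + α)))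
    (discr_secondConic hα hs)

section Mem

variable (hα : α ^ 2 + α + 2 = 0) {s : ℂ} (hs : s ^ 2 = 1)

theorem axisConic_mem : axisConic hα ∈ conicsOf (octahedralQuartic α) := by
  refine conicCurve_mem_conicsOf (p := ![0, 1, 0]) (fun h => by simpa using congrFun h 1) 0 2 0
    fun v => ?_
  rw [eval_polarForm_octahedralQuartic, eval_conicForm]
  simp only [Matrix.cons_val]
  ring

theorem diagonalConic_mem : diagonalConic hα hs ∈ conicsOf (octahedralQuartic α) := by
  refine conicCurve_mem_conicsOf (p := ![1, s, 0]) (fun h => by simpa using congrFun h 0)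
    2 (2 * s) 0 fun v => ?_
  rw [eval_polarForm_octahedralQuartic, eval_conicForm]
  simp only [Matrix.cons_val]
  grind

theorem oppositeConic_mem : oppositeConic hα ∈ conicsOf (octahedralQuartic α) := by
  refine conicCurve_mem_conicsOf (p := ![0, 1, 1]) (fun h => by simpa using congrFun h 1) 0 2 2
    fun v => ?_
  rw [eval_polarForm_octahedralQuartic, eval_conicForm]
  simp only [Matrix.cons_val]
  ring

theorem firstConic_mem : firstConic hα hs ∈ conicsOf (octahedralQuartic α) := by
  refine conicCurve_mem_conicsOf (p := ![α, s, s])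
    (fun h => ne_zero_of_octahedral hα (by simpa using congrFun h 0))
    ((α + 2) * (1 + α)) (-(α + 2) * s) (-(α + 2) * s) fun v => ?_
  rw [eval_polarForm_octahedralQuartic, eval_conicForm]
  simp only [Matrix.cons_val]
  grind

theorem secondConic_mem : secondConic hα hs ∈ conicsOf (octahedralQuartic α) := by
  refine conicCurve_mem_conicsOf (p := ![s, α, 1]) (fun h => by simpa using congrFun h 2)
    (2 * s) (-(2 + 2 * α)) 2 fun v => ?_
  rw [eval_polarForm_octahedralQuartic, eval_conicForm]
  simp only [Matrix.cons_val]
  grind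

end Mem

theorem exists_add_mul_eq (e f : ℂ) : ∃ y z : ℂ, y + z = e ∧ y * z = f := by
  obtain ⟨δ, hδ⟩ := IsAlgClosed.exists_pow_nat_eq (e ^ 2 - 4 * f) (n := 2) two_pos
  exact ⟨(e + δ) / 2, (e - δ) / 2, by ring, by linear_combination -hδ / 4⟩

theorem three_le_mult_axis_diagonal (hα : α ^ 2 + α + 2 = 0) {z : ℂ} (h : z ^ 2 = (α - 2) / 3) :
    3 ≤ arrangementMult (conicsOf (octahedralQuartic α)) (affinePoint (1, z)) := by
  have hone : (1 : ℂ) ^ 2 = 1 := one_pow 2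
  refine three_le_arrangementMult (baseConic_mem (ne_zero_of_octahedral hα)) (axisConic_mem hα)
    (diagonalConic_mem hα hone) (fun h => ?_) (fun h => ?_) (fun h => ?_)
    ((contains_baseConic_affinePoint hα).2 ?_) (contains_conicCurve_affinePoint.2 ?_)
    (contains_conicCurve_affinePoint.2 ?_)
  iterate 3
    · obtain ⟨r, h⟩ := exists_smul_of_conicCurve_eq h
      grind
  all_goals grind

theorem three_le_mult_diagonal_diagonal (hα : α ^ 2 + α + 2 = 0) {z : ℂ} (h : z ^ 2 = (1 + α) / 3) :
    3 ≤ arrangementMult (conicsOf (octahedralQuartic α)) (affinePoint (0, z)) := by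
  have hone : (1 : ℂ) ^ 2 = 1 := one_pow 2
  have hneg : (-1 : ℂ) ^ 2 = 1 := by norm_num
  refine three_le_arrangementMult (baseConic_mem (ne_zero_of_octahedral hα))
    (diagonalConic_mem hα hone) (diagonalConic_mem hα hneg) (fun h => ?_) (fun h => ?_)
    (fun h => ?_) ((contains_baseConic_affinePoint hα).2 ?_) (contains_conicCurve_affinePoint.2 ?_)
    (contains_conicCurve_affinePoint.2 ?_)
  iterate 3
    · obtain ⟨r, h⟩ := exists_smul_of_conicCurve_eq h
      grind
  all_goals grind

theorem three_le_mult_opposite_first (hα : α ^ 2 + α + 2 = 0) {y z : ℂ}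
    (h : y + z = -(1 + α)) (h' : y * z = (α - 2) / 3) :
    3 ≤ arrangementMult (conicsOf (octahedralQuartic α)) (affinePoint (y, z)) := by
  have hone : (1 : ℂ) ^ 2 = 1 := one_pow 2
  refine three_le_arrangementMult (baseConic_mem (ne_zero_of_octahedral hα)) (oppositeConic_mem hα)
    (firstConic_mem hα hone) (fun h => ?_) (fun h => ?_) (fun h => ?_)
    ((contains_baseConic_affinePoint hα).2 ?_) (contains_conicCurve_affinePoint.2 ?_)
    (contains_conicCurve_affinePoint.2 ?_)
  iterate 3
    · obtain ⟨r, h⟩ := exists_smul_of_conicCurve_eq h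
      grind
  all_goals grind

theorem three_le_mult_first_first (hα : α ^ 2 + α + 2 = 0) {y : ℂ} (h : y ^ 2 = (1 + α) / 6) :
    3 ≤ arrangementMult (conicsOf (octahedralQuartic α)) (affinePoint (y, -y)) := by
  have hone : (1 : ℂ) ^ 2 = 1 := one_pow 2
  have hneg : (-1 : ℂ) ^ 2 = 1 := by norm_num
  refine three_le_arrangementMult (baseConic_mem (ne_zero_of_octahedral hα))
    (firstConic_mem hα hone) (firstConic_mem hα hneg) (fun h => ?_) (fun h => ?_)
    (fun h => ?_) ((contains_baseConic_affinePoint hα).2 ?_) (contains_conicCurve_affinePoint.2 ?_)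
    (contains_conicCurve_affinePoint.2 ?_)
  iterate 3
    · obtain ⟨r, h⟩ := exists_smul_of_conicCurve_eq h
      grind
  all_goals grind

theorem three_le_mult_second_second (hα : α ^ 2 + α + 2 = 0) {z : ℂ} (h : z ^ 2 = -1 / 3) :
    3 ≤ arrangementMult (conicsOf (octahedralQuartic α)) (affinePoint (α * z, z)) := by
  have hone : (1 : ℂ) ^ 2 = 1 := one_pow 2
  have hneg : (-1 : ℂ) ^ 2 = 1 := by norm_num
  refine three_le_arrangementMult (baseConic_mem (ne_zero_of_octahedral hα))
    (secondConic_mem hα hone) (secondConic_mem hα hneg) (fun h => ?_) (fun h => ?_)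
    (fun h => ?_) ((contains_baseConic_affinePoint hα).2 ?_) (contains_conicCurve_affinePoint.2 ?_)
    (contains_conicCurve_affinePoint.2 ?_)
  iterate 3
    · obtain ⟨r, h⟩ := exists_smul_of_conicCurve_eq h
      grind
  all_goals grind

/-- Apart from two triple points, the conic of `(1 : α : 1)` meets the base conic on the line
`z = x + (1 + α) y`. -/
theorem two_le_mult_second (hα : α ^ 2 + α + 2 = 0) {y : ℂ}
    (h : y ^ 2 = (α - 1) * y + (2 + α) / 3) :
    2 ≤ arrangementMult (conicsOf (octahedralQuartic α)) (affinePoint (y, 1 + (1 + α) * y)) := by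
  refine two_le_arrangementMult (baseConic_mem (ne_zero_of_octahedral hα))
    (secondConic_mem hα (one_pow 2)) (fun h => ?_) ((contains_baseConic_affinePoint hα).2 ?_)
    (contains_conicCurve_affinePoint.2 ?_)
  · obtain ⟨r, h⟩ := exists_smul_of_conicCurve_eq h
    grind
  · grind
  · grind

/-- The values of the invariant `(y z)²` on the seven orbits of points on the base conic are
distinct, so that the orbits are disjoint. -/
theorem injective_orbit_invariants (hα : α ^ 2 + α + 2 = 0) {y₅ y₆ : ℂ} (h : y₅ + y₆ = α - 1)
    (h' : y₅ * y₆ = -(2 + α) / 3) :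
    Function.Injective ![(α - 2) / 3, 0, (2 - 5 * α) / 9, (α - 1) / 36, -(α + 2) / 9,
      (2 * α / 3 - (α + 2) * y₅) ^ 2, (2 * α / 3 - (α + 2) * y₆) ^ 2] := by
  have key : ∀ i j : Fin 7, i < j → ![(α - 2) / 3, 0, (2 - 5 * α) / 9, (α - 1) / 36, -(α + 2) / 9,
      (2 * α / 3 - (α + 2) * y₅) ^ 2, (2 * α / 3 - (α + 2) * y₆) ^ 2] i ≠
      ![(α - 2) / 3, 0, (2 - 5 * α) / 9, (α - 1) / 36, -(α + 2) / 9,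
      (2 * α / 3 - (α + 2) * y₅) ^ 2, (2 * α / 3 - (α + 2) * y₆) ^ 2] j := by
    intro i j hij
    fin_cases i <;> fin_cases j <;>
      first
      | exact absurd hij (by decide)
      | (simp only [Fin.reduceFinMk, Fin.zero_eta, Fin.mk_one, Matrix.cons_val]; grind)
  intro i j h
  rcases lt_trichotomy i j with hij | hij | hij
  · exact absurd h (key i j hij)
  · exact hij
  · exact absurd h.symm (key j i hij)

/-- Representatives of the seven orbits: five orbits of triple points and two of double points. -/
theorem exists_orbit_representatives (hα : α ^ 2 + α + 2 = 0) :
    ∃ q : Fin 7 → ℂ × ℂ,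
      (∀ i, (q i).1 ^ 2 + (q i).2 ^ 2 = (1 + α) / 3) ∧
      (∀ i j, ((q i).1 * (q i).2) ^ 2 = ((q j).1 * (q j).2) ^ 2 → i = j) ∧
      (∀ i, (squareOrbit (q i)).card = ![8, 4, 8, 4, 8, 8, 8] i) ∧
      (∀ i, i < 5 → 3 ≤ arrangementMult (conicsOf (octahedralQuartic α)) (affinePoint (q i))) ∧
      ∀ i, 5 ≤ i → 2 ≤ arrangementMult (conicsOf (octahedralQuartic α)) (affinePoint (q i)) := by
  obtain ⟨z₀, h₀⟩ := IsAlgClosed.exists_pow_nat_eq ((α - 2) / 3) (n := 2) two_pos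
  obtain ⟨z₁, h₁⟩ := IsAlgClosed.exists_pow_nat_eq ((1 + α) / 3) (n := 2) two_pos
  obtain ⟨y₂, z₂, h₂, h₂'⟩ := exists_add_mul_eq (-(1 + α)) ((α - 2) / 3)
  obtain ⟨y₃, h₃⟩ := IsAlgClosed.exists_pow_nat_eq ((1 + α) / 6) (n := 2) two_pos
  obtain ⟨z₄, h₄⟩ := IsAlgClosed.exists_pow_nat_eq (-1 / 3 : ℂ) (n := 2) two_pos
  obtain ⟨y₅, y₆, h₅, h₅'⟩ := exists_add_mul_eq (α - 1) (-(2 + α) / 3)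
  refine ⟨![(1, z₀), (0, z₁), (y₂, z₂), (y₃, -y₃), (α * z₄, z₄),
    (y₅, 1 + (1 + α) * y₅), (y₆, 1 + (1 + α) * y₆)], fun i => ?_, fun i j h => ?_, fun i => ?_,
    fun i hi => ?_, fun i hi => ?_⟩
  · fin_cases i <;> simp <;> grind
  · refine injective_orbit_invariants hα h₅ h₅' ?_
    have key : ∀ i : Fin 7, ![(α - 2) / 3, 0, (2 - 5 * α) / 9, (α - 1) / 36, -(α + 2) / 9,
        (2 * α / 3 - (α + 2) * y₅) ^ 2, (2 * α / 3 - (α + 2) * y₆) ^ 2] i =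
        ((![(1, z₀), (0, z₁), (y₂, z₂), (y₃, -y₃), (α * z₄, z₄), (y₅, 1 + (1 + α) * y₅),
          (y₆, 1 + (1 + α) * y₆)] i).1 * (![(1, z₀), (0, z₁), (y₂, z₂), (y₃, -y₃), (α * z₄, z₄),
          (y₅, 1 + (1 + α) * y₅), (y₆, 1 + (1 + α) * y₆)] i).2) ^ 2 := by
      intro i
      clear h
      fin_cases i <;> simp <;> grind
    rw [key, key, h]
  · fin_cases i
    · exact card_squareOrbit (by simp) (by simp; grind) (by simp; grind)
    · exact card_squareOrbit_zero (by grind)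
    · exact card_squareOrbit (by simp; grind) (by simp; grind) (by simp; grind)
    · exact card_squareOrbit_neg (by grind)
    · exact card_squareOrbit (by simp; grind) (by simp; grind) (by simp; grind)
    · exact card_squareOrbit (by simp; grind) (by simp; grind) (by simp; grind)
    · exact card_squareOrbit (by simp; grind) (by simp; grind) (by simp; grind)
  · fin_cases i
    · exact three_le_mult_axis_diagonal hα h₀
    · exact three_le_mult_diagonal_diagonal hα h₁
    · exact three_le_mult_opposite_first hα h₂ h₂'
    · exact three_le_mult_first_first hα h₃
    · exact three_le_mult_second_second hα h₄
    · exact absurd hi (by decide)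
    · exact absurd hi (by decide)
  · fin_cases i
    iterate 5 exact absurd hi (by decide)
    · exact two_le_mult_second hα (by grind)
    · exact two_le_mult_second hα (by grind)

/-- The base conic is balanced in the arrangement of the octahedral quartic, provided that this
arrangement has 21 members. -/
theorem isBalanced_baseConic (hα : α ^ 2 + α + 2 = 0)
    (hcard : (conicsOf (octahedralQuartic α)).encard = 21) :
    IsBalanced (conicsOf (octahedralQuartic α)) (baseConic (ne_zero_of_octahedral hα)) := by
  classical
  obtain ⟨q, hsum, hinj, hsize, htriple, hdouble⟩ := exists_orbit_representatives hα
  have hdisj : ∀ I : Finset (Fin 7),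
      ((I : Set (Fin 7)).PairwiseDisjoint fun i => squareOrbit (q i)) := by
    intro I i _ j _ hij
    refine Finset.disjoint_left.2 fun r hi hj => hij (hinj i j ?_)
    rw [← sq_mul_squareOrbit hi, sq_mul_squareOrbit hj]
  let pts : Finset (Fin 7) → Finset ProjPlane := fun I =>
    (I.biUnion fun i => squareOrbit (q i)).image affinePoint
  have hcardpts : ∀ I, (pts I).card = ∑ i ∈ I, (![8, 4, 8, 4, 8, 8, 8] : Fin 7 → ℕ) i := fun I => by
    rw [Finset.card_image_of_injective _ affinePoint_injective, Finset.card_biUnion (hdisj I)]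
    exact Finset.sum_congr rfl fun i _ => hsize i
  have hmem : ∀ {I P}, P ∈ pts I → ∃ i ∈ I, ∃ r ∈ squareOrbit (q i), affinePoint r = P := by
    intro I P hP
    obtain ⟨r, hr, rfl⟩ := Finset.mem_image.1 hP
    obtain ⟨i, hi, hr⟩ := Finset.mem_biUnion.1 hr
    exact ⟨i, hi, r, hr, rfl⟩
  have hbase : ∀ {I P}, P ∈ pts I → Contains (baseConic (ne_zero_of_octahedral hα)) P := by
    intro I P hP
    obtain ⟨i, -, r, hr, rfl⟩ := hmem hP
    rw [contains_baseConic_affinePoint hα, sq_add_sq_squareOrbit hr, hsum]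
  have h0 := ne_zero_of_octahedral hα
  refine isBalanced_of_points hcard (baseConic_mem h0)
    (fun Q _ hne => (encard_baseConic_inter_le h0 hne).1)
    (fun Q _ hne => (encard_baseConic_inter_le h0 hne).2)
    (T := pts {0, 1, 2, 3, 4}) (D := pts {5, 6}) ?_ ?_ ?_ ?_ ?_
  · refine Finset.disjoint_left.2 fun P hT hD => ?_
    obtain ⟨i, hi, r, hr, hP⟩ := hmem hT
    obtain ⟨j, hj, r', hr', rfl⟩ := hmem hD
    obtain rfl := affinePoint_injective hP
    have : i = j := hinj i j (by rw [← sq_mul_squareOrbit hr, sq_mul_squareOrbit hr'])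
    subst this
    revert hi hj
    fin_cases i <;> decide
  · rw [hcardpts]
    rfl
  · rw [hcardpts]
    rfl
  · intro P hP
    refine ⟨hbase hP, ?_⟩
    obtain ⟨i, hi, r, hr, rfl⟩ := hmem hP
    rw [arrangementMult_squareOrbit α hr]
    refine htriple i ?_
    clear hr hP
    fin_cases i <;> revert hi <;> decide
  · intro P hP
    refine ⟨hbase hP, ?_⟩
    obtain ⟨i, hi, r, hr, rfl⟩ := hmem hP
    rw [arrangementMult_squareOrbit α hr]
    refine hdouble i ?_
    clear hr hP
    fin_cases i <;> revert hi <;> decide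

end Octahedral

/-! ### The equivalence with the Klein quartic -/

section SeventhRoot

variable {ζ : ℂ}

/-- The circulant change of coordinates that takes the octahedral quartic to the Klein quartic. Its
columns are the cyclic permutations of `kleinCentre ζ`. -/
def kleinChange (hζ : IsPrimitiveRoot ζ 7) : CoordChange :=
  CoordChange.ofMatrix
    !![1, -(ζ + ζ ^ 2 + ζ ^ 5), ζ ^ 4 + ζ ^ 5;
      ζ ^ 4 + ζ ^ 5, 1, -(ζ + ζ ^ 2 + ζ ^ 5);
      -(ζ + ζ ^ 2 + ζ ^ 5), ζ ^ 4 + ζ ^ 5, 1] fun v hv => by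
    have hΦ := hζ.cyclotomic_seven
    obtain ⟨b, hb⟩ : ∃ b, b = ζ ^ 4 + ζ ^ 5 := ⟨_, rfl⟩
    obtain ⟨c, hc⟩ : ∃ c, c = -(ζ + ζ ^ 2 + ζ ^ 5) := ⟨_, rfl⟩
    rw [← hb, ← hc] at hv
    have hdet : 1 + b ^ 3 + c ^ 3 - 3 * b * c ≠ 0 := by grind
    have e0 := congrFun hv 0
    have e1 := congrFun hv 1
    have e2 := congrFun hv 2
    simp [Matrix.mulVec, dotProduct, Fin.sum_univ_three] at e0 e1 e2
    have k : ∀ t : ℂ, (1 + b ^ 3 + c ^ 3 - 3 * b * c) * t = 0 → t = 0 := fun t ht =>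
      (mul_eq_zero.1 ht).resolve_left hdet
    ext i
    fin_cases i
    · change v 0 = 0
      refine k _ ?_
      linear_combination (1 - b * c) * e0 + (b ^ 2 - c) * e1 + (c ^ 2 - b) * e2
    · change v 1 = 0
      refine k _ ?_
      linear_combination (c ^ 2 - b) * e0 + (1 - b * c) * e1 + (b ^ 2 - c) * e2
    · change v 2 = 0
      refine k _ ?_
      linear_combination (b ^ 2 - c) * e0 + (c ^ 2 - b) * e1 + (1 - b * c) * e2

theorem kleinChange_single (hζ : IsPrimitiveRoot ζ 7) :
    kleinChange hζ ![1, 0, 0] = kleinCentre ζ := by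
  rw [kleinChange, CoordChange.ofMatrix_apply]
  ext i
  fin_cases i <;> simp [Matrix.mulVec, dotProduct, Fin.sum_univ_three, kleinCentre]

/-- For `b = ζ⁴ + ζ⁵` and `c = -(ζ + ζ² + ζ⁵)` the substitution kills the coefficients of `x³y`,
`x³z` and `x²yz` in the Klein quartic, and those of `x⁴` and `x²y²` have the ratio `1 : 3α`. -/
theorem substForm_kleinChange (hζ : IsPrimitiveRoot ζ 7) : ∃ l : ℂ, l ≠ 0 ∧
    substForm (kleinChange hζ) kleinQuartic = l • octahedralQuartic (ζ + ζ ^ 2 + ζ ^ 4) := by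
  have hΦ := hζ.cyclotomic_seven
  obtain ⟨b, hb⟩ : ∃ b, b = ζ ^ 4 + ζ ^ 5 := ⟨_, rfl⟩
  obtain ⟨c, hc⟩ : ∃ c, c = -(ζ + ζ ^ 2 + ζ ^ 5) := ⟨_, rfl⟩
  obtain ⟨α, hα⟩ : ∃ α, α = ζ + ζ ^ 2 + ζ ^ 4 := ⟨_, rfl⟩
  refine ⟨b + b ^ 3 * c + c ^ 3, by grind, MvPolynomial.funext fun v => ?_⟩
  rw [eval_substForm, smul_eval, eval_kleinQuartic, eval_octahedralQuartic, kleinChange,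
    CoordChange.ofMatrix_apply, ← hb, ← hc, ← hα]
  simp only [Matrix.mulVec, dotProduct, Fin.sum_univ_three, Matrix.of_apply, Matrix.cons_val]
  -- the coefficients of `x³y`, `x³z`, `x²yz` and `x²y²`
  have h₁ : 1 + c ^ 4 + 3 * b * c + 3 * b * c ^ 2 + 3 * b ^ 2 * c + b ^ 4 = 0 := by grind
  have h₂ : c + 3 * c ^ 2 + b * c ^ 3 + 3 * b ^ 2 + 3 * b ^ 2 * c ^ 2 + b ^ 3 = 0 := by grind
  have h₃ : c ^ 2 + c ^ 3 + b + 2 * b * c + 2 * b * c ^ 2 + b ^ 2 + 2 * b ^ 2 * c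
      + b ^ 2 * c ^ 2 + b ^ 3 * c = 0 := by grind
  have h₄ : c + b * c + b * c ^ 2 + b * c ^ 3 + b ^ 2 * c + b ^ 3
      = (b + b ^ 3 * c + c ^ 3) * α := by grind
  generalize v 0 = x
  generalize v 1 = y
  generalize v 2 = z
  linear_combination (x ^ 3 * y + y ^ 3 * z + z ^ 3 * x) * h₁
    + (x ^ 3 * z + y ^ 3 * x + z ^ 3 * y) * h₂ + 3 * x * y * z * (x + y + z) * h₃
    + 3 * (x ^ 2 * y ^ 2 + y ^ 2 * z ^ 2 + z ^ 2 * x ^ 2) * h₄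

/-- The first coordinate point, the centre of the involution `x ↦ -x`. -/
def firstPoint : Fin 3 → ℂ := ![1, 0, 0]

theorem firstPoint_ne_zero : firstPoint ≠ 0 := fun h => by simpa [firstPoint] using congrFun h 0

/-- There are 21 equivalences between the two quartics such that each reducible polar of the Klein
quartic corresponds to the polar of the first coordinate point under exactly one of them. -/
theorem exists_klein_equivalences : ∃ (α : ℂ) (_ : α ^ 2 + α + 2 = 0)
    (g : Fin 3 × Fin 7 → CoordChange),
    (∀ x, ∃ l : ℂ, l ≠ 0 ∧ substForm (g x) (octahedralQuartic α) = l • kleinQuartic) ∧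
    (∀ p u : Fin 3 → ℂ, p ≠ 0 → u ≠ 0 →
      (∀ v, u ⬝ᵥ v = 0 → eval v (polarForm kleinQuartic p) = 0) →
      ∃ x, ∃ s : ℂ, p = s • (g x)⁻¹ firstPoint) ∧
    ∀ x y, ∀ s : ℂ, (g x)⁻¹ firstPoint = s • (g y)⁻¹ firstPoint → x = y := by
  obtain ⟨ζ, hζ⟩ : ∃ ζ : ℂ, IsPrimitiveRoot ζ 7 :=
    ⟨_, Complex.isPrimitiveRoot_exp 7 (by norm_num)⟩
  have hΦ := hζ.cyclotomic_seven
  obtain ⟨l, hl, hM⟩ := substForm_kleinChange hζ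
  have hpt : ∀ k j, (((kleinChange hζ)⁻¹ * (frobeniusChange hζ k j)⁻¹)⁻¹ : CoordChange) firstPoint
      = frobeniusChange hζ k j (kleinCentre ζ) := fun k j => by
    rw [mul_inv_rev, inv_inv, inv_inv, LinearEquiv.mul_apply, firstPoint, kleinChange_single]
  refine ⟨ζ + ζ ^ 2 + ζ ^ 4, by grind,
    fun x => (kleinChange hζ)⁻¹ * (frobeniusChange hζ x.1 x.2)⁻¹, fun x => ?_, ?_, ?_⟩
  · refine ⟨l⁻¹, inv_ne_zero hl, ?_⟩
    have h1 : octahedralQuartic (ζ + ζ ^ 2 + ζ ^ 4) =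
        l⁻¹ • substForm (kleinChange hζ) kleinQuartic := by
      rw [hM, smul_smul, inv_mul_cancel₀ hl, one_smul]
    have h2 : substForm (frobeniusChange hζ x.1 x.2)⁻¹ kleinQuartic = kleinQuartic := by
      conv_lhs => rw [← substForm_frobeniusChange hζ x.1 x.2]
      rw [substForm_substForm, mul_inv_cancel, substForm_one]
    rw [h1, map_smul, substForm_substForm, mul_inv_cancel_left, h2]
  · intro p u hp hu h
    obtain ⟨k, j, s, hs⟩ := exists_eq_frobeniusChange hζ hp hu h
    exact ⟨(k, j), s, by rw [hpt, hs]⟩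
  · intro x y s h
    rw [hpt, hpt] at h
    obtain ⟨h1, h2⟩ := frobeniusChange_kleinCentre_injective hζ h
    exact Prod.ext h1 h2

end SeventhRoot

/-! ### The arrangement of the 21 conics -/

/-- A polar of the Klein quartic that contains a smooth conic is reducible for reasons of degree, so
that the reducibility can be left out of the definition of the arrangement. -/
theorem polarConics_eq_conicsOf : polarConics = conicsOf kleinQuartic := by
  ext Q
  constructor
  · rintro ⟨hQ, Γ, ⟨-, p, c, hΓ⟩, hdvd⟩
    rw [IsPartOf, hΓ, dvd_smul_iff c.ne_zero] at hdvd
    exact ⟨hQ, p.rep, p.rep_nonzero, hdvd⟩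
  · rintro ⟨hQ, p, hp, hdvd⟩
    have hhom : (polarForm kleinQuartic p).IsHomogeneous 3 :=
      isHomogeneous_polarForm isHomogeneous_kleinQuartic p
    have hne := polarForm_kleinQuartic_ne_zero hp
    obtain ⟨c, hc, hform⟩ := exists_form_ofForm _ hhom hne
    obtain ⟨a, ha⟩ := Projectivization.exists_smul_eq_mk_rep ℂ p hp
    have hdvd' : form Q ∣ form (ofForm _ hhom hne) := by rwa [hform, dvd_smul_iff hc]
    refine ⟨hQ, ofForm _ hhom hne, ⟨?_, Projectivization.mk ℂ p hp, Units.mk0 c hc * a⁻¹, ?_⟩,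
      hdvd'⟩
    · exact exists_mul_of_conic_dvd hQ (isHomogeneous_form _) (form_ne_zero _) hdvd'
    · rw [hform, ← ha, Units.smul_def, polarForm_smul, smul_smul, Units.val_mul, mul_assoc,
        ← Units.val_mul, inv_mul_cancel, Units.val_one, mul_one, Units.val_mk0]

theorem exists_line_of_mem_kleinReduciblePolars {Γ : PlaneCurve 3} (hΓ : Γ ∈ kleinReduciblePolars) :
    ∃ p u : Fin 3 → ℂ, ∃ c : ℂ, p ≠ 0 ∧ c ≠ 0 ∧ form Γ = c • polarForm kleinQuartic p ∧ u ≠ 0 ∧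
      ∀ v, u ⬝ᵥ v = 0 → eval v (polarForm kleinQuartic p) = 0 := by
  obtain ⟨⟨A, B, hA, hB, hAB⟩, p, c, hform⟩ := hΓ
  have hhom := isHomogeneous_form Γ
  have hne := form_ne_zero Γ
  rw [hAB] at hhom hne
  obtain ⟨u, hu, h⟩ := exists_line_of_cubic_eq_mul hhom hne hA hB
  refine ⟨p.rep, u, c, p.rep_nonzero, c.ne_zero, hform, hu, fun v hv => ?_⟩
  have := h v hv
  rw [← hAB, hform, smul_eval] at this
  exact (mul_eq_zero.1 this).resolve_left c.ne_zero

/-- The reducible polars and the conics of the arrangement, indexed by the 21 equivalences with the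
octahedral quartic. -/
theorem exists_polars_and_conics : ∃ (Γ : Fin 3 × Fin 7 → PlaneCurve 3)
    (Q : Fin 3 × Fin 7 → PlaneCurve 2),
    Function.Injective Γ ∧ Function.Injective Q ∧
    kleinReduciblePolars = Set.range Γ ∧ polarConics = Set.range Q ∧
    (∀ x, IsSmooth (Q x) ∧ IsPartOf (Q x) (Γ x)) ∧ ∀ x, IsBalanced polarConics (Q x) := by
  obtain ⟨α, hα, g, hg, hline, hinj⟩ := exists_klein_equivalences
  have h0 := ne_zero_of_octahedral hα
  have hα' : 4 - 6 * α ≠ 0 := by grind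
  let p : Fin 3 × Fin 7 → Fin 3 → ℂ := fun x => (g x)⁻¹ firstPoint
  have hp : ∀ x, p x ≠ 0 := fun x =>
    (map_ne_zero_iff _ (g x)⁻¹.injective).2 firstPoint_ne_zero
  let Q : Fin 3 × Fin 7 → PlaneCurve 2 := fun x => pull (g x) (baseConic h0)
  have hQs : ∀ x, IsSmooth (Q x) := fun x => isSmooth_pull _ isSmooth_conicCurve
  have hbase : form (baseConic h0) ∣ polarForm (octahedralQuartic α) firstPoint := by
    obtain ⟨-, q, hq, hdvd⟩ := baseConic_mem h0
    have h1 := eq_smul_of_baseConic_dvd h0 hα' hdvd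
    have h2 : q 0 ≠ 0 := fun h => hq (by rw [h1, h, zero_smul])
    rwa [h1, polarForm_smul, dvd_smul_iff h2] at hdvd
  -- the conic `Q x` is contained in the polar of `q` exactly if `q` is the point `p x`
  have hdvd : ∀ x q, form (Q x) ∣ polarForm kleinQuartic q ↔
      form (baseConic h0) ∣ polarForm (octahedralQuartic α) (g x q) := by
    intro x q
    obtain ⟨l, hl, hgl⟩ := hg x
    rw [← form_pull_dvd_polarForm_iff, hgl, polarForm_smul_form, dvd_smul_iff hl]
  have hgp : ∀ x, g x (p x) = firstPoint := fun x => by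
    rw [← LinearEquiv.mul_apply, mul_inv_cancel, LinearEquiv.coe_one, id]
  have hQp : ∀ x, form (Q x) ∣ polarForm kleinQuartic (p x) := fun x => by
    rw [hdvd, hgp]
    exact hbase
  have hQinj : Function.Injective Q := by
    intro x y hxy
    have h1 := hQp x
    rw [hxy, hdvd] at h1
    have h2 := eq_smul_of_baseConic_dvd h0 hα' h1
    refine hinj x y (g y (p x) 0) ?_
    change p x = _ • p y
    apply (g y).injective
    rw [map_smul, hgp]
    exact h2
  have hhom : ∀ q, (polarForm kleinQuartic q).IsHomogeneous 3 := fun q =>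
    isHomogeneous_polarForm isHomogeneous_kleinQuartic q
  have hne : ∀ x, polarForm kleinQuartic (p x) ≠ 0 := fun x =>
    polarForm_kleinQuartic_ne_zero (hp x)
  let Γ : Fin 3 × Fin 7 → PlaneCurve 3 := fun x => ofForm _ (hhom (p x)) (hne x)
  have hΓ : ∀ x, ∃ c : ℂ, c ≠ 0 ∧ form (Γ x) = c • polarForm kleinQuartic (p x) := fun x =>
    exists_form_ofForm _ _ _
  have hQΓ : ∀ x, form (Q x) ∣ form (Γ x) := fun x => by
    obtain ⟨c, hc, hform⟩ := hΓ x
    rw [hform, dvd_smul_iff hc]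
    exact hQp x
  have hQmem : ∀ x, Q x ∈ conicsOf kleinQuartic := fun x => ⟨hQs x, p x, hp x, hQp x⟩
  have hΓmem : ∀ x, Γ x ∈ kleinReduciblePolars := by
    intro x
    obtain ⟨c, hc, hform⟩ := hΓ x
    obtain ⟨a, ha⟩ := Projectivization.exists_smul_eq_mk_rep ℂ (p x) (hp x)
    refine ⟨exists_mul_of_conic_dvd (hQs x) (isHomogeneous_form _) (form_ne_zero _) (hQΓ x),
      Projectivization.mk ℂ (p x) (hp x), Units.mk0 c hc * a⁻¹, ?_⟩
    rw [hform, ← ha, Units.smul_def, polarForm_smul, smul_smul, Units.val_mul, mul_assoc,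
      ← Units.val_mul, inv_mul_cancel, Units.val_one, mul_one, Units.val_mk0]
  have hΓinj : Function.Injective Γ := fun x y hxy => hQinj
    (eq_of_isSmooth_of_dvd (hQs y) (isHomogeneous_form (Γ y)) (form_ne_zero _) (hQΓ y)
      (hxy ▸ hQΓ x))
  have hΓrange : kleinReduciblePolars = Set.range Γ := by
    refine Set.Subset.antisymm (fun Δ hΔ => ?_) (Set.range_subset_iff.2 hΓmem)
    obtain ⟨q, u, c, hq, hc, hform, hu, h⟩ := exists_line_of_mem_kleinReduciblePolars hΔ
    obtain ⟨x, s, rfl⟩ := hline q u hq hu h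
    obtain ⟨c', hc', hform'⟩ := hΓ x
    refine ⟨x, (ext_form (c := c * s * c'⁻¹) ?_).symm⟩
    rw [hform, hform', polarForm_smul, smul_smul, smul_smul, mul_assoc (c * s),
      inv_mul_cancel₀ hc', mul_one]
  have hQrange : conicsOf kleinQuartic = Set.range Q := by
    refine Set.Subset.antisymm (fun R hR => ?_) (Set.range_subset_iff.2 hQmem)
    rw [← polarConics_eq_conicsOf] at hR
    obtain ⟨hRs, Δ, hΔ, hdvd'⟩ := hR
    rw [hΓrange] at hΔ
    obtain ⟨x, rfl⟩ := hΔ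
    exact ⟨x, (eq_of_isSmooth_of_dvd (hQs x) (isHomogeneous_form (Γ x)) (form_ne_zero _) (hQΓ x)
      hdvd').symm⟩
  have himage : ∀ x, pull (g x) '' conicsOf (octahedralQuartic α) = conicsOf kleinQuartic := by
    intro x
    obtain ⟨l, hl, hgl⟩ := hg x
    rw [image_pull_conicsOf, hgl, conicsOf_smul _ hl]
  have hcard : (conicsOf (octahedralQuartic α)).encard = 21 := by
    rw [← (pull_injective (g (0, 0))).encard_image, himage, hQrange, ← Set.image_univ,
      hQinj.encard_image]
    simp [Set.encard_univ]
  refine ⟨Γ, Q, hΓinj, hQinj, hΓrange, by rw [polarConics_eq_conicsOf, hQrange],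
    fun x => ⟨hQs x, hQΓ x⟩, fun x => ?_⟩
  rw [polarConics_eq_conicsOf, ← himage x]
  exact (isBalanced_baseConic hα hcard).pull (g x)

end

theorem mainTheorem3 :
    -- there are 21 reducible polars, and they yield 21 smooth conics, one for each polar
    kleinReduciblePolars.encard = 21 ∧
    (∀ Γ ∈ kleinReduciblePolars,
      ∃! Q : PlaneCurve 2, PlaneCurve.IsSmooth Q ∧ PlaneCurve.IsPartOf Q Γ) ∧
    polarConics.encard = 21 ∧
    -- every singular point is ordinary, and is a double or a triple point
    (∀ P ∈ arrangementSing polarConics,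
      IsOrdinaryAt polarConics P ∧
        (arrangementMult polarConics P = 2 ∨ arrangementMult polarConics P = 3)) ∧
    -- the numbers of triple and of double points
    {P : ProjPlane | arrangementMult polarConics P = 3}.encard = 224 ∧
    {P : ProjPlane | arrangementMult polarConics P = 2}.encard = 168 := by
  obtain ⟨Γ, Q, hΓinj, hQinj, hΓ, hQ, hQΓ, hbal⟩ := exists_polars_and_conics
  have hbal' : ∀ R ∈ polarConics, IsBalanced polarConics R := by
    intro R hR
    rw [hQ] at hR
    obtain ⟨x, rfl⟩ := hR
    exact hbal x
  have hcard : polarConics.encard = 21 := by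
    rw [hQ, ← Set.image_univ, hQinj.encard_image]
    simp [Set.encard_univ]
  refine ⟨?_, ?_, hcard, ?_, ?_, ?_⟩
  · rw [hΓ, ← Set.image_univ, hΓinj.encard_image]
    simp [Set.encard_univ]
  · intro Δ hΔ
    rw [hΓ] at hΔ
    obtain ⟨x, rfl⟩ := hΔ
    exact ⟨Q x, hQΓ x, fun R hR => eq_of_isSmooth_of_dvd (hQΓ x).1 (isHomogeneous_form (Γ x))
      (form_ne_zero _) (hQΓ x).2 hR.2⟩
  · intro P hP
    have hsm : ∀ R ∈ curvesThrough polarConics P, formGradient (form R) P.rep ≠ 0 := fun R hR =>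
      hR.1.1 P hR.2
    have h2 : 2 ≤ arrangementMult polarConics P := by
      rcases hP with h | ⟨R, hR, h⟩
      · exact h
      · exact absurd h (hsm R hR)
    refine ⟨⟨hsm, fun R hR R' hR' hne =>
      (hbal' R hR.1).transversal R' hR'.1 hne.symm P hR.2 hR'.2⟩, ?_⟩
    obtain ⟨R, hR⟩ : (curvesThrough polarConics P).Nonempty := by
      rw [← Set.encard_ne_zero]
      intro h
      rw [arrangementMult, h] at h2
      exact absurd h2 (by norm_num)
    have h3 := (hbal' R hR.1).mult_le P hR.2
    obtain ⟨n, hn⟩ := ENat.ne_top_iff_exists.1 (ne_top_of_le_ne_top (by decide) h3)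
    rw [← hn] at h2 h3 ⊢
    have h2' : 2 ≤ n := by exact_mod_cast h2
    have h3' : n ≤ 3 := by exact_mod_cast h3
    rcases (by omega : n = 2 ∨ n = 3) with rfl | rfl
    · exact Or.inl rfl
    · exact Or.inr rfl
  · obtain ⟨x, hx, h⟩ := encard_mult_mul (N := 21) (k := 32) (n := 3) hcard three_ne_zero
      fun R hR => (hbal' R hR).triple
    obtain rfl : x = 224 := by omega
    exact hx
  · obtain ⟨x, hx, h⟩ := encard_mult_mul (N := 21) (k := 16) (n := 2) hcard two_ne_zero
      fun R hR => (hbal' R hR).double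
    obtain rfl : x = 168 := by omega
    exact hx
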